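/- Let $n\ge 2$, $0<s<1$, $1\le p<n/s$, $0<\lambda<1$, and $p^*_s=\frac{np}{n-sp}$. For an open set $\Omega\subseteq\mathbb R^n$ and a function $u$ on $\Omega$ put $$[u]_{s,p,\Omega}^p=\int_\Omega\int_\Omega\frac{|u(x)-u(y)|^p}{|x-y|^{n+sp}}\,dx\,dy ,$$ and let $W^{s,p}(\Omega)$ be the set of $u\in L^p(\Omega)$ with $[u]_{s,p,\Omega}<\infty$. For compact $K\subset\Omega$ let $$\mathrm{Cap}_{s,p}(K,\Omega)=\inf\{[v]^p_{s,p,\Omega}: v\in C_c^\infty(\Omega),\ v\ge 1\text{ on }K\};$$ for open $A\subset\Omega$ let $\mathrm{Cap}_{s,p}(A,\Omega)=\sup\{\mathrm{Cap}_{s,p}(K,\Omega): K\subset A\text{ compact}\}$; and for arbitrary $E\subset\Omega$ let $\mathrm{Cap}_{s,p}(E,\Omega)=\inf\{\mathrm{Cap}_{s,p}(A,\Omega): E\subset A\subset\Omega,\ A\text{ open}\}$. A function $u:\Omega\to\mathbb R$ is $(s,p)$-quasi continuous in $\Omega$ if for every $\varepsilon>0$ there is an open set $E\subset\Omega$ with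 $\mathrm{Cap}_{s,p}(E,\Omega)<\varepsilon$ such that $u|_{\Omega\setminus E}$ is continuous. Then there is a constant $C=C(n,s,p,\lambda)>0$ such that the following holds for every open ball $B=B_r(x_0)\subset\mathbb R^n$, $r>0$, and every $(s,p)$-quasi continuous function $u\in W^{s,p}(B)$. Let $Z(u)=\{x\in B:u(x)=0\}$ and let $\lambda\overline B$ be the closed ball with center $x_0$ and radius $\lambda r$. If $\mathrm{Cap}_{s,p}(Z(u)\cap\lambda\overline B,B)>0$, then $$\left(\frac1{|B|}\int_B|u(x)|^{p^*_s}\,dx\right)^{1/p^*_s}\le C\left(\frac{1}{\mathrm{Cap}_{s,p}(Z(u)\cap\lambda\overline B,B)}\int_B\int_B\frac{|u(x)-u(y)|^p}{|x-y|^{n+sp}}\,dx\,dy\right)^{1/p}.$$ -/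

import Mathlib

open MeasureTheory Set Filter Topology
open scoped ENNReal ContDiff

/-- The `p`-th power `[u]_{s,p,Ω}^p` of the Gagliardo seminorm, as an extended nonnegative number:
`∫_Ω ∫_Ω |u(x) - u(y)|^p / |x - y|^(n + s p) dx dy`. -/
noncomputable def gagliardoPow {n : ℕ} (s p : ℝ) (Ω : Set (EuclideanSpace ℝ (Fin n)))
    (u : EuclideanSpace ℝ (Fin n) → ℝ) : ℝ≥0∞ :=
  ∫⁻ x in Ω, ∫⁻ y in Ω, ‖u x - u y‖ₑ ^ p / ‖x - y‖ₑ ^ ((n : ℝ) + s * p)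

/-- `u ∈ W^{s,p}(Ω)`: `u ∈ L^p(Ω)` and the Gagliardo seminorm of `u` on `Ω` is finite.
Only the values of `u` on `Ω` matter. -/
def MemFracSobolev {n : ℕ} (s p : ℝ) (Ω : Set (EuclideanSpace ℝ (Fin n)))
    (u : EuclideanSpace ℝ (Fin n) → ℝ) : Prop :=
  MemLp u (ENNReal.ofReal p) (volume.restrict Ω) ∧ gagliardoPow s p Ω u < ⊤

/-- `u ∈ C_c^∞(Ω)` (functions on `Ω` are identified with their extension by zero). -/
def IsTestFunction {n : ℕ} (Ω : Set (EuclideanSpace ℝ (Fin n)))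
    (u : EuclideanSpace ℝ (Fin n) → ℝ) : Prop :=
  ContDiff ℝ ∞ u ∧ HasCompactSupport u ∧ tsupport u ⊆ Ω

/-- The variational `(s,p)`-capacity of a compact set `K ⊆ Ω`. -/
noncomputable def compactCap {n : ℕ} (s p : ℝ) (K Ω : Set (EuclideanSpace ℝ (Fin n))) : ℝ≥0∞ :=
  ⨅ (u : EuclideanSpace ℝ (Fin n) → ℝ) (_ : IsTestFunction Ω u) (_ : ∀ x ∈ K, 1 ≤ u x),
    gagliardoPow s p Ω u

/-- The variational `(s,p)`-capacity of an open set `A ⊆ Ω`. -/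
noncomputable def openCap {n : ℕ} (s p : ℝ) (A Ω : Set (EuclideanSpace ℝ (Fin n))) : ℝ≥0∞ :=
  ⨆ (K : Set (EuclideanSpace ℝ (Fin n))) (_ : IsCompact K) (_ : K ⊆ A), compactCap s p K Ω

/-- The variational `(s,p)`-capacity `Cap_{s,p}(E, Ω)` of an arbitrary set `E ⊆ Ω`. For open and
for compact `E` it agrees with the two definitions above (`fracCap_eq_openCap`,
`fracCap_eq_compactCap`). -/
noncomputable def fracCap {n : ℕ} (s p : ℝ) (E Ω : Set (EuclideanSpace ℝ (Fin n))) : ℝ≥0∞ :=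
  ⨅ (A : Set (EuclideanSpace ℝ (Fin n))) (_ : IsOpen A) (_ : E ⊆ A) (_ : A ⊆ Ω), openCap s p A Ω

/-- `u` is `(s,p)`-quasi continuous in `Ω`. -/
def IsFracQuasiContinuous {n : ℕ} (s p : ℝ) (Ω : Set (EuclideanSpace ℝ (Fin n)))
    (u : EuclideanSpace ℝ (Fin n) → ℝ) : Prop :=
  ∀ ε : ℝ, 0 < ε → ∃ E : Set (EuclideanSpace ℝ (Fin n)), IsOpen E ∧ E ⊆ Ω ∧
    fracCap s p E Ω < ENNReal.ofReal ε ∧ ContinuousOn u (Ω \ E)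

/-- The zero set `Z(u)` of a function `u` on `Ω`. -/
def zeroSetIn {n : ℕ} (Ω : Set (EuclideanSpace ℝ (Fin n)))
    (u : EuclideanSpace ℝ (Fin n) → ℝ) : Set (EuclideanSpace ℝ (Fin n)) :=
  {x | x ∈ Ω ∧ u x = 0}

/-- The fractional Sobolev exponent `p*_s = n p / (n - s p)` (used for `s p < n`). -/
noncomputable def fracSobolevExp (n : ℕ) (s p : ℝ) : ℝ := n * p / (n - s * p)

theorem fracCap_eq_openCap {n : ℕ} (s p : ℝ) {A Ω : Set (EuclideanSpace ℝ (Fin n))}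
    (hA : IsOpen A) (hAΩ : A ⊆ Ω) : fracCap s p A Ω = openCap s p A Ω := by
  apply le_antisymm
  · exact iInf_le_of_le A (iInf_le_of_le hA (iInf_le_of_le subset_rfl (iInf_le_of_le hAΩ le_rfl)))
  · refine le_iInf fun A' => le_iInf fun _ => le_iInf fun h => le_iInf fun _ => ?_
    refine iSup_le fun K => iSup_le fun hK => iSup_le fun hKA => ?_
    exact le_iSup_of_le K (le_iSup_of_le hK (le_iSup_of_le (hKA.trans h) le_rfl))

theorem gagliardoPow_const_mul {n : ℕ} (s : ℝ) {p : ℝ} (hp : 0 ≤ p)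
    (Ω : Set (EuclideanSpace ℝ (Fin n))) (u : EuclideanSpace ℝ (Fin n) → ℝ) (t : ℝ) :
    gagliardoPow s p Ω (fun x => t * u x) = ‖t‖ₑ ^ p * gagliardoPow s p Ω u := by
  have ht : ‖t‖ₑ ^ p ≠ ⊤ := ENNReal.rpow_ne_top_of_nonneg hp enorm_ne_top
  unfold gagliardoPow
  rw [← lintegral_const_mul' _ _ ht]
  congr 1
  funext x
  rw [← lintegral_const_mul' _ _ ht]
  congr 1
  funext y
  rw [← mul_sub, enorm_mul, ENNReal.mul_rpow_of_nonneg _ _ hp, mul_div_assoc]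

theorem fracCap_eq_compactCap {n : ℕ} (s : ℝ) {p : ℝ} (hp : 0 ≤ p)
    {K Ω : Set (EuclideanSpace ℝ (Fin n))} (hΩ : IsOpen Ω) (hK : IsCompact K) (hKΩ : K ⊆ Ω) :
    fracCap s p K Ω = compactCap s p K Ω := by
  apply le_antisymm
  · refine le_iInf fun u => le_iInf fun hu => le_iInf fun h1 => ?_
    have key : ∀ t : ℝ, 1 < t → fracCap s p K Ω ≤ ‖t‖ₑ ^ p * gagliardoPow s p Ω u := by
      intro t ht
      have hopen : IsOpen (Ω ∩ {x | 1 < t * u x}) :=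
        hΩ.inter (isOpen_lt continuous_const (continuous_const.mul hu.1.continuous))
      have hsub : K ⊆ Ω ∩ {x | 1 < t * u x} := fun x hx =>
        ⟨hKΩ hx, by have := h1 x hx; simp only [mem_ofPred_eq]; nlinarith⟩
      refine iInf_le_of_le _ (iInf_le_of_le hopen (iInf_le_of_le hsub
        (iInf_le_of_le inter_subset_left ?_)))
      refine iSup_le fun K' => iSup_le fun _ => iSup_le fun hK' => ?_
      rw [← gagliardoPow_const_mul s hp]
      refine iInf_le_of_le (fun x => t * u x) (iInf_le_of_le ⟨?_, ?_, ?_⟩ (iInf_le_of_le ?_ le_rfl))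
      · exact contDiff_const.mul hu.1
      · exact hu.2.1.mul_left
      · exact (tsupport_mul_subset_right (f := fun _ => t) (g := u)).trans hu.2.2
      · exact fun x hx => (hK' hx).2.le
    have hc : Tendsto (fun t : ℝ => ‖t‖ₑ ^ p * gagliardoPow s p Ω u) (𝓝[>] 1)
        (𝓝 (gagliardoPow s p Ω u)) := by
      have h0 : Tendsto (fun t : ℝ => ‖t‖ₑ ^ p) (𝓝[>] 1) (𝓝 1) := by
        have : Continuous (fun t : ℝ => ‖t‖ₑ ^ p) :=
          ENNReal.continuous_rpow_const.comp continuous_enorm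
        have h := (this.tendsto 1).mono_left (nhdsWithin_le_nhds (s := Ioi 1))
        simpa using h
      simpa using ENNReal.Tendsto.mul_const (b := gagliardoPow s p Ω u) h0 (Or.inl one_ne_zero)
    exact ge_of_tendsto hc (eventually_nhdsWithin_of_forall fun t ht => key t ht)
  · refine le_iInf fun A => le_iInf fun _ => le_iInf fun h => le_iInf fun _ => ?_
    exact le_iSup_of_le K (le_iSup_of_le hK (le_iSup_of_le h le_rfl))

/-! Let `a` be the normalized `L^{p*}` norm of `u` on the ball, `p*` being `fracSobolevExp n s p`.
If `a` is zero there is nothing to prove. Otherwise the function `w = η · (1 - |u|/a)₊`, with `η` a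
Lipschitz cutoff equal to one on the smaller closed ball, equals one on the part of the zero set
inside that ball, so its energy should dominate the capacity up to a constant. If moreover the
energy of `w` is at most a constant times `a^(-p)` times the energy of `u`, then `a^p · cap ≤ D ·
[u]^p`, and dividing by the capacity gives the theorem.

The energy bound (`exists_fracCap_zeroSet_le`) splits by the product rule
`exists_gagliardoPow_interpolate_le`. One term is the energy of `|u|/a`. The other is `r^(-sp) ∫ (1
- |u|/a)₊^p`, whose integrand is at most `a^(-p) ||u| - a|^p`; it is controlled because `|u|` is
close in `L^p` to the constant `a` (`exists_lintegral_sub_average_le`). That closeness follows from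
the Sobolev–Poincaré inequality on balls, proved by superlevel sets: pairs with `f x > 2t` and `f y
≤ t` interact strongly when `{f ≤ t}` fills half the ball, which bounds an integral of the
distribution function. A dichotomy between levels `t` and `2t` and a Lorentz embedding turn this
into the `L^{p*}` bound.

The capacity bound (`fracCap_le_of_quasiContinuous`) has to cope with `w` being only quasi
continuous. Off an open set `G` of small capacity `{w > 1/2}` is relatively open, so together with
`G` it is an open neighbourhood of the set. The maximum of `2w` and a potential of `G` is at least
one a.e. there, and mollifying it yields test functions. The potential is an a.e. limit of
competitors for compact subsets of `G`; an `L²` parallelogram argument produces it also for `p = 1`.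
-/

/-! ### Elementary properties of the Gagliardo energy -/

section Energy
variable {n : ℕ}
local notation "𝔼" => EuclideanSpace ℝ (Fin n)

theorem measurable_gagliardo_integrand (p q : ℝ) {u : 𝔼 → ℝ} (hu : Measurable u) :
    Measurable fun z : 𝔼 × 𝔼 => ‖u z.1 - u z.2‖ₑ ^ p / ‖z.1 - z.2‖ₑ ^ q := by
  fun_prop

theorem measurable_gagliardo_section (p q : ℝ) {u : 𝔼 → ℝ} (hu : Measurable u) (x : 𝔼) :
    Measurable fun y : 𝔼 => ‖u x - u y‖ₑ ^ p / ‖x - y‖ₑ ^ q := by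
  fun_prop

/-- Functions in the Sobolev class are only a.e. measurable; this allows passing to a measurable
representative. -/
theorem gagliardoPow_congr_ae {s p : ℝ} {Ω : Set 𝔼} {u v : 𝔼 → ℝ}
    (h : u =ᵐ[volume.restrict Ω] v) : gagliardoPow s p Ω u = gagliardoPow s p Ω v := by
  unfold gagliardoPow
  refine lintegral_congr_ae ?_
  filter_upwards [h] with x hx
  refine lintegral_congr_ae ?_
  filter_upwards [h] with y hy
  rw [hx, hy]

/-- Turns a pointwise bound on increments into a bound on energies. Only the dominating functions
have to be measurable. -/
theorem gagliardoPow_le_add {s p : ℝ} {Ω : Set 𝔼} (hΩ : MeasurableSet Ω) {u v w : 𝔼 → ℝ}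
    (hu : Measurable u) (hv : Measurable v) (a b : ℝ≥0∞)
    (h : ∀ x ∈ Ω, ∀ y ∈ Ω,
      ‖w x - w y‖ₑ ^ p ≤ a * ‖u x - u y‖ₑ ^ p + b * ‖v x - v y‖ₑ ^ p) :
    gagliardoPow s p Ω w ≤ a * gagliardoPow s p Ω u + b * gagliardoPow s p Ω v := by
  have hmu := measurable_gagliardo_integrand p ((n : ℝ) + s * p) hu
  have hmv := measurable_gagliardo_integrand p ((n : ℝ) + s * p) hv
  have hiu := hmu.lintegral_prod_right' (ν := volume.restrict Ω)
  have hiv := hmv.lintegral_prod_right' (ν := volume.restrict Ω)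
  unfold gagliardoPow
  rw [← lintegral_const_mul _ hiu, ← lintegral_const_mul _ hiv,
    ← lintegral_add_left (hiu.const_mul a)]
  refine setLIntegral_mono' hΩ fun x hx => ?_
  have hmux := measurable_gagliardo_section p ((n : ℝ) + s * p) hu x
  have hmvx := measurable_gagliardo_section p ((n : ℝ) + s * p) hv x
  rw [← lintegral_const_mul _ hmux, ← lintegral_const_mul _ hmvx,
    ← lintegral_add_left (hmux.const_mul a)]
  refine setLIntegral_mono' hΩ fun y hy => ?_
  rw [← mul_div_assoc, ← mul_div_assoc, ← ENNReal.add_div]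
  exact ENNReal.div_le_div_right (h x hx y hy) _

theorem gagliardoPow_mono {s p : ℝ} (hp : 0 ≤ p) {Ω : Set 𝔼} (hΩ : MeasurableSet Ω) {u w : 𝔼 → ℝ}
    (h : ∀ x ∈ Ω, ∀ y ∈ Ω, |w x - w y| ≤ |u x - u y|) :
    gagliardoPow s p Ω w ≤ gagliardoPow s p Ω u := by
  unfold gagliardoPow
  refine setLIntegral_mono' hΩ fun x hx => setLIntegral_mono' hΩ fun y hy => ?_
  gcongr
  exact enorm_le_iff_norm_le.2 (h x hx y hy)

/-- An increment of a maximum is bounded by one of the two increments, hence by the sum of their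
powers, without any extra constant. -/
theorem gagliardoPow_max_le {s p : ℝ} (hp : 0 ≤ p) {Ω : Set 𝔼} (hΩ : MeasurableSet Ω)
    {u v : 𝔼 → ℝ} (hu : Measurable u) (hv : Measurable v) :
    gagliardoPow s p Ω (fun x => max (u x) (v x)) ≤
      gagliardoPow s p Ω u + gagliardoPow s p Ω v := by
  have := gagliardoPow_le_add (s := s) (p := p) hΩ (w := fun x => max (u x) (v x)) hu hv 1 1 ?_
  · simpa using this
  intro x _ y _
  have h := abs_max_sub_max_le_max (u x) (v x) (u y) (v y)
  rw [one_mul, one_mul]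
  rcases le_max_iff.1 h with h | h
  · exact le_add_right (ENNReal.rpow_le_rpow (enorm_le_iff_norm_le.2 h) hp)
  · exact le_add_left (ENNReal.rpow_le_rpow (enorm_le_iff_norm_le.2 h) hp)

theorem enorm_convexComb_rpow_le {p : ℝ} (hp : 1 ≤ p) {t : ℝ} (ht0 : 0 ≤ t) (ht1 : t ≤ 1)
    (a b : ℝ) : ‖(1 - t) * a + t * b‖ₑ ^ p ≤
      ENNReal.ofReal (1 - t) * ‖a‖ₑ ^ p + ENNReal.ofReal t * ‖b‖ₑ ^ p := by
  refine le_trans ?_ (ENNReal.rpow_arith_mean_le_arith_mean2_rpow _ _ _ _ ?_ hp)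
  · gcongr
    refine (enorm_add_le _ _).trans ?_
    rw [enorm_mul, enorm_mul, Real.enorm_of_nonneg (sub_nonneg.2 ht1), Real.enorm_of_nonneg ht0]
  · rw [← ENNReal.ofReal_add (sub_nonneg.2 ht1) ht0]
    simp

theorem gagliardoPow_midpoint_le {s p : ℝ} (hp : 1 ≤ p) {Ω : Set 𝔼} (hΩ : MeasurableSet Ω)
    {u v : 𝔼 → ℝ} (hu : Measurable u) (hv : Measurable v) {ε : ℝ≥0∞}
    (hue : gagliardoPow s p Ω u ≤ ε) (hve : gagliardoPow s p Ω v ≤ ε) :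
    gagliardoPow s p Ω (fun x => (u x + v x) / 2) ≤ ε := by
  have := gagliardoPow_le_add (s := s) (p := p) hΩ (w := fun x => (u x + v x) / 2) hu hv
    (1 / 2) (1 / 2) ?_
  · calc _ ≤ _ := this
      _ ≤ 1 / 2 * ε + 1 / 2 * ε := by gcongr
      _ = ε := by rw [← add_mul, ENNReal.add_halves, one_mul]
  intro x _ y _
  have h := enorm_convexComb_rpow_le hp (t := 1 / 2) (by norm_num) (by norm_num)
    (u x - u y) (v x - v y)
  have e : ENNReal.ofReal (1 / 2) = 1 / 2 := by
    rw [ENNReal.ofReal_div_of_pos two_pos]; simp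
  rw [show (1 : ℝ) - 1 / 2 = 1 / 2 by norm_num, e] at h
  convert h using 3
  ring

/-- Fatou's lemma, once in each variable. -/
theorem gagliardoPow_le_of_tendsto_ae {s p : ℝ} {Ω : Set 𝔼}
    {u : ℕ → 𝔼 → ℝ} (hu : ∀ k, Measurable (u k)) {v : 𝔼 → ℝ} {ε : ℝ≥0∞}
    (hε : ∀ k, gagliardoPow s p Ω (u k) ≤ ε)
    (hlim : ∀ᵐ x ∂volume.restrict Ω, Tendsto (fun k => u k x) atTop (𝓝 (v x))) :
    gagliardoPow s p Ω v ≤ ε := by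
  have hm k := measurable_gagliardo_integrand p ((n : ℝ) + s * p) (hu k)
  calc gagliardoPow s p Ω v
      ≤ ∫⁻ x in Ω, liminf (fun k => ∫⁻ y in Ω,
          ‖u k x - u k y‖ₑ ^ p / ‖x - y‖ₑ ^ ((n : ℝ) + s * p)) atTop := by
        refine lintegral_mono_ae ?_
        filter_upwards [hlim] with x hx
        refine le_trans (lintegral_mono_ae ?_)
          (lintegral_liminf_le fun k => measurable_gagliardo_section p _ (hu k) x)
        filter_upwards [hlim] with y hy
        -- On the diagonal both sides are the same constant; off it the denominator is nonzero and
        -- the quotient passes to the limit.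
        by_cases hxy : x = y
        · subst hxy
          simp
        refine le_of_eq (Tendsto.liminf_eq ?_).symm
        have h1 : Tendsto (fun k => ‖u k x - u k y‖ₑ ^ p) atTop (𝓝 (‖v x - v y‖ₑ ^ p)) :=
          (ENNReal.continuous_rpow_const.tendsto _).comp ((continuous_enorm.tendsto _).comp
            (hx.sub hy))
        refine ENNReal.Tendsto.div_const h1 (Or.inr ?_)
        have h0 : ‖x - y‖ₑ ≠ 0 := by simpa [sub_eq_zero] using hxy
        simp [ENNReal.rpow_eq_zero_iff, h0]
    _ ≤ liminf (fun k => gagliardoPow s p Ω (u k)) atTop :=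
        lintegral_liminf_le fun k => (hm k).lintegral_prod_right'
    _ ≤ liminf (fun _ : ℕ => ε) atTop := liminf_le_liminf (Eventually.of_forall hε)
    _ = ε := by simp

end Energy

/-! ### Gluing two functions with a Lipschitz cutoff -/

section Cutoff
variable {n : ℕ}
local notation "𝔼" => EuclideanSpace ℝ (Fin n)

/-- The integrand is `‖z‖` to the power `-n + p(1 - s)`, and `p(1 - s) > 0`. -/
theorem lintegral_kernel_ball_lt_top (hn : 1 ≤ n) {s p : ℝ} (hs1 : s < 1) (hp : 0 < p) (R : ℝ) :
    ∫⁻ z in Metric.ball (0 : 𝔼) R, ‖z‖ₑ ^ p / ‖z‖ₑ ^ ((n : ℝ) + s * p) < ⊤ := by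
  have h := integrableOn_ball_of_norm_le_rpow (μ := (volume : Measure 𝔼))
    (f := fun z : 𝔼 => ‖z‖ ^ (-((n : ℝ) + s * p - p))) (C := 1) (α := (n : ℝ) + s * p - p) (r := R)
    (by simpa using hn) (by simp; nlinarith) ?_ ?_
  · refine lt_of_le_of_lt (lintegral_mono_ae ?_) h.2
    have h0 : ∀ᵐ z : 𝔼, z ≠ 0 := by
      have : Nontrivial 𝔼 := by
        have : Nonempty (Fin n) := ⟨⟨0, hn⟩⟩
        infer_instance
      simp [ae_iff]
    filter_upwards [ae_restrict_of_ae h0] with z hz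
    have hz' : 0 < ‖z‖ := norm_pos_iff.2 hz
    rw [← ENNReal.rpow_sub _ _ (by simpa using hz) enorm_ne_top,
      Real.enorm_of_nonneg (by positivity), ← ENNReal.ofReal_rpow_of_pos hz', ofReal_norm]
    apply le_of_eq
    congr 1
    ring
  · filter_upwards with z
    rw [one_mul, Real.norm_of_nonneg (by positivity)]
  · exact (measurable_norm.pow_const _).aestronglyMeasurable

theorem lintegral_comp_smul_eq {E : Type*} [NormedAddCommGroup E] [NormedSpace ℝ E]
    [FiniteDimensional ℝ E] [MeasurableSpace E] [BorelSpace E] (μ : Measure E)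
    [μ.IsAddHaarMeasure] {f : E → ℝ≥0∞} {r : ℝ} (hr : 0 < r) :
    ∫⁻ x, f x ∂μ = ENNReal.ofReal r ^ (Module.finrank ℝ E : ℝ) * ∫⁻ z, f (r • z) ∂μ := by
  have h := Measure.map_addHaar_smul μ hr.ne'
  have h2 : ∫⁻ z, f (r • z) ∂μ = ∫⁻ x, f x ∂(Measure.map (r • ·) μ) :=
    ((Homeomorph.smulOfNeZero r hr.ne').toMeasurableEquiv.measurableEmbedding.lintegral_map f).symm
  rw [h2, h, lintegral_smul_measure, smul_eq_mul, ← mul_assoc]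
  rw [abs_of_pos (by positivity), ENNReal.rpow_natCast, ← ENNReal.ofReal_pow hr.le,
    ← ENNReal.ofReal_mul (by positivity), mul_inv_cancel₀ (by positivity)]
  simp

/-- Seen from a point of the ball, the ball lies within distance `2r`; translation and scaling by
`r` then reduce to the ball of radius two about the origin. -/
theorem lintegral_kernel_ball_le {s p : ℝ} (x₀ : 𝔼) {r : ℝ} (hr : 0 < r) {x : 𝔼}
    (hx : x ∈ Metric.ball x₀ r) :
    ∫⁻ y in Metric.ball x₀ r, ‖x - y‖ₑ ^ p / ‖x - y‖ₑ ^ ((n : ℝ) + s * p) ≤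
      (∫⁻ z in Metric.ball (0 : 𝔼) 2, ‖z‖ₑ ^ p / ‖z‖ₑ ^ ((n : ℝ) + s * p)) *
        ENNReal.ofReal r ^ (p - s * p) := by
  set k : 𝔼 → ℝ≥0∞ := fun z => ‖z‖ₑ ^ p / ‖z‖ₑ ^ ((n : ℝ) + s * p) with hk
  have hr0 : ENNReal.ofReal r ≠ 0 := by simpa using hr
  have hscale : ∀ z : 𝔼, k (r • z) =
      ENNReal.ofReal r ^ (p - ((n : ℝ) + s * p)) * k z := by
    intro z
    have e : ‖r • z‖ₑ = ENNReal.ofReal r * ‖z‖ₑ := by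
      rw [enorm_smul, Real.enorm_of_nonneg hr.le]
    simp only [hk, e]
    rw [ENNReal.rpow_sub _ _ hr0 ENNReal.ofReal_ne_top]
    have h1 : ∀ a : ℝ, (ENNReal.ofReal r * ‖z‖ₑ) ^ a = ENNReal.ofReal r ^ a * ‖z‖ₑ ^ a := fun a =>
      ENNReal.mul_rpow_of_ne_top ENNReal.ofReal_ne_top enorm_ne_top a
    rw [h1, h1, div_eq_mul_inv, div_eq_mul_inv, div_eq_mul_inv,
      ENNReal.mul_inv (Or.inl ?_) (Or.inl ?_)]
    · ring
    · simp [hr0]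
    · simp [hr0]
  calc ∫⁻ y in Metric.ball x₀ r, k (x - y)
      = ∫⁻ y, (Metric.ball x₀ r).indicator (fun y => k (x - y)) y :=
        (lintegral_indicator Metric.isOpen_ball.measurableSet _).symm
    _ ≤ ∫⁻ y, (Metric.ball (0 : 𝔼) (2 * r)).indicator k (x - y) := by
        refine lintegral_mono fun y => ?_
        by_cases hy : y ∈ Metric.ball x₀ r
        · rw [indicator_of_mem hy, indicator_of_mem]
          rw [mem_ball_zero_iff, ← dist_eq_norm]
          calc dist x y ≤ dist x x₀ + dist y x₀ := dist_triangle_right _ _ _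
            _ < 2 * r := by rw [Metric.mem_ball] at hx hy; linarith
        · rw [indicator_of_notMem hy]; exact bot_le
    _ = ∫⁻ y, (Metric.ball (0 : 𝔼) (2 * r)).indicator k y :=
        lintegral_sub_left_eq_self _ x
    _ = ENNReal.ofReal r ^ (n : ℝ) *
          ∫⁻ z, (Metric.ball (0 : 𝔼) (2 * r)).indicator k (r • z) := by
        simpa using lintegral_comp_smul_eq (volume : Measure 𝔼) hr
    _ = ENNReal.ofReal r ^ (n : ℝ) * ∫⁻ z, ENNReal.ofReal r ^ (p - ((n : ℝ) + s * p)) *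
          (Metric.ball (0 : 𝔼) 2).indicator k z := by
        congr 2
        funext z
        by_cases hz : z ∈ Metric.ball (0 : 𝔼) 2
        · rw [indicator_of_mem hz, indicator_of_mem, hscale]
          rw [mem_ball_zero_iff] at hz ⊢
          rw [norm_smul, Real.norm_of_nonneg hr.le]
          nlinarith
        · rw [indicator_of_notMem hz, indicator_of_notMem, mul_zero]
          rw [mem_ball_zero_iff, not_lt] at hz ⊢
          rw [norm_smul, Real.norm_of_nonneg hr.le]
          nlinarith
    _ = _ := by
        rw [lintegral_const_mul' _ _ (by simp [hr0]),
          lintegral_indicator Metric.isOpen_ball.measurableSet, ← mul_assoc,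
          ← ENNReal.rpow_add _ _ hr0 ENNReal.ofReal_ne_top, mul_comm]
        congr 2
        ring

/-- A fractional product rule. The error involves only `h - g`, so gluing two functions that are
close in `L^p` costs almost nothing; with `g = 0` it is the usual cutoff estimate. -/
theorem exists_gagliardoPow_interpolate_le (hn : 1 ≤ n) {s p : ℝ} (hs1 : s < 1) (hp : 1 ≤ p) :
    ∃ C : ℝ≥0∞, C ≠ ⊤ ∧ ∀ (x₀ : 𝔼) (r : ℝ), 0 < r → ∀ (L : ℝ) (ζ g h : 𝔼 → ℝ), 0 ≤ L →
      Measurable g → Measurable h → (∀ x, ζ x ∈ Icc (0 : ℝ) 1) →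
      (∀ x y, |ζ x - ζ y| ≤ L * ‖x - y‖) →
      gagliardoPow s p (Metric.ball x₀ r) (fun x => (1 - ζ x) * g x + ζ x * h x) ≤
        2 ^ (p - 1) * (gagliardoPow s p (Metric.ball x₀ r) g +
          gagliardoPow s p (Metric.ball x₀ r) h +
          C * ENNReal.ofReal L ^ p * ENNReal.ofReal r ^ (p - s * p) *
            ∫⁻ x in Metric.ball x₀ r, ‖h x - g x‖ₑ ^ p) := by
  refine ⟨_, (lintegral_kernel_ball_lt_top (n := n) hn hs1 (by linarith) 2).ne, ?_⟩
  intro x₀ r hr L ζ g h hL hg hh hζ hζL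
  have hp0 : 0 ≤ p := by linarith
  set C := ∫⁻ z in Metric.ball (0 : 𝔼) 2, ‖z‖ₑ ^ p / ‖z‖ₑ ^ ((n : ℝ) + s * p) with hC
  set q := (n : ℝ) + s * p with hq
  set B := Metric.ball x₀ r
  have hB : MeasurableSet B := Metric.isOpen_ball.measurableSet
  have hc : (2 : ℝ≥0∞) ^ (p - 1) ≠ ⊤ := ENNReal.rpow_ne_top_of_nonneg (by linarith) (by simp)
  have hpt : ∀ x y : 𝔼, ‖(1 - ζ x) * g x + ζ x * h x - ((1 - ζ y) * g y + ζ y * h y)‖ₑ ^ p ≤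
      2 ^ (p - 1) * (‖g x - g y‖ₑ ^ p + ‖h x - h y‖ₑ ^ p +
        ENNReal.ofReal L ^ p * ‖h x - g x‖ₑ ^ p * ‖x - y‖ₑ ^ p) := by
    intro x y
    -- The convex weights are taken at `y` and the difference `h - g` at `x`, so that in the error
    -- term the integral over `y` involves only the kernel.
    have e : (1 - ζ x) * g x + ζ x * h x - ((1 - ζ y) * g y + ζ y * h y) =
        ((1 - ζ y) * (g x - g y) + ζ y * (h x - h y)) + (ζ x - ζ y) * (h x - g x) := by ring
    rw [e]
    refine (ENNReal.rpow_le_rpow (enorm_add_le _ _) hp0).trans ?_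
    refine (ENNReal.rpow_add_le_mul_rpow_add_rpow _ _ hp).trans ?_
    gcongr
    · refine (enorm_convexComb_rpow_le hp (hζ y).1 (hζ y).2 _ _).trans ?_
      gcongr
      · refine mul_le_of_le_one_left' ?_
        rw [ENNReal.ofReal_le_one]; linarith [(hζ y).1]
      · refine mul_le_of_le_one_left' ?_
        rw [ENNReal.ofReal_le_one]; exact (hζ y).2
    · have h1 : ‖ζ x - ζ y‖ₑ ≤ ENNReal.ofReal L * ‖x - y‖ₑ := by
        rw [← ofReal_norm (ζ x - ζ y), ← ofReal_norm (x - y), ← ENNReal.ofReal_mul hL]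
        exact ENNReal.ofReal_le_ofReal (hζL x y)
      rw [enorm_mul, ← ENNReal.mul_rpow_of_nonneg _ _ hp0, ← ENNReal.mul_rpow_of_nonneg _ _ hp0]
      refine ENNReal.rpow_le_rpow ?_ hp0
      calc _ ≤ ENNReal.ofReal L * ‖x - y‖ₑ * ‖h x - g x‖ₑ := by gcongr
        _ = _ := by ring
  have hmg := measurable_gagliardo_integrand p q hg
  have hmh := measurable_gagliardo_integrand p q hh
  have hig : Measurable fun x => ∫⁻ y in B, ‖g x - g y‖ₑ ^ p / ‖x - y‖ₑ ^ q :=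
    hmg.lintegral_prod_right'
  have hih : Measurable fun x => ∫⁻ y in B, ‖h x - h y‖ₑ ^ p / ‖x - y‖ₑ ^ q :=
    hmh.lintegral_prod_right'
  have hsum : Measurable fun x => (∫⁻ y in B, ‖g x - g y‖ₑ ^ p / ‖x - y‖ₑ ^ q) +
      ∫⁻ y in B, ‖h x - h y‖ₑ ^ p / ‖x - y‖ₑ ^ q := hig.add hih
  unfold gagliardoPow
  rw [← hq]
  have hmd : Measurable fun x => ‖h x - g x‖ₑ ^ p := by fun_prop
  rw [← lintegral_const_mul _ hmd, ← lintegral_add_left hig, ← lintegral_add_left hsum,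
    ← lintegral_const_mul' _ _ hc]
  refine setLIntegral_mono' hB fun x hx => ?_
  have hmgx := measurable_gagliardo_section p q hg x
  have hmhx := measurable_gagliardo_section p q hh x
  have hsumx : Measurable fun y => ‖g x - g y‖ₑ ^ p / ‖x - y‖ₑ ^ q +
      ‖h x - h y‖ₑ ^ p / ‖x - y‖ₑ ^ q := hmgx.add hmhx
  calc _ ≤ ∫⁻ y in B, 2 ^ (p - 1) * (‖g x - g y‖ₑ ^ p / ‖x - y‖ₑ ^ q +
        ‖h x - h y‖ₑ ^ p / ‖x - y‖ₑ ^ q +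
        (ENNReal.ofReal L ^ p * ‖h x - g x‖ₑ ^ p) * (‖x - y‖ₑ ^ p / ‖x - y‖ₑ ^ q)) := by
        refine lintegral_mono fun y => ?_
        refine (ENNReal.div_le_div_right (hpt x y) _).trans (le_of_eq ?_)
        simp only [div_eq_mul_inv]
        ring
    _ = 2 ^ (p - 1) * ((∫⁻ y in B, ‖g x - g y‖ₑ ^ p / ‖x - y‖ₑ ^ q) +
        (∫⁻ y in B, ‖h x - h y‖ₑ ^ p / ‖x - y‖ₑ ^ q) +
        (ENNReal.ofReal L ^ p * ‖h x - g x‖ₑ ^ p) *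
          ∫⁻ y in B, (‖x - y‖ₑ ^ p / ‖x - y‖ₑ ^ q)) := by
        rw [lintegral_const_mul' _ _ hc, lintegral_add_left hsumx,
          lintegral_add_left hmgx, lintegral_const_mul _ (by fun_prop)]
    _ ≤ _ := by
        refine mul_le_mul_right (add_le_add le_rfl ?_) _
        refine (mul_le_mul_right (lintegral_kernel_ball_le x₀ hr hx) _).trans (le_of_eq ?_)
        rw [← hC]
        ring

end Cutoff

/-! ### Existence of a median -/

section Median

/-- The median is the infimum of the levels whose strict superlevel set has at most half the mass;
continuity of the measure along increasing unions gives both bounds at the infimum. -/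
theorem exists_median {α : Type*} [MeasurableSpace α] (μ : Measure α) [IsFiniteMeasure μ]
    {f : α → ℝ} (hf : Measurable f) :
    ∃ m : ℝ, μ {x | m < f x} ≤ μ univ / 2 ∧ μ {x | f x < m} ≤ μ univ / 2 := by
  rcases eq_or_ne (μ univ) 0 with h0 | h0
  · exact ⟨0, (measure_mono (subset_univ _)).trans (by simp [h0]),
      (measure_mono (subset_univ _)).trans (by simp [h0])⟩
  have hV : μ univ ≠ ⊤ := measure_ne_top _ _
  set S : Set ℝ := {t | μ {x | t < f x} ≤ μ univ / 2} with hS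
  have hne : S.Nonempty := by
    have h1 : Tendsto (fun k : ℕ => μ {x | (k : ℝ) < f x}) atTop (𝓝 0) := by
      have := tendsto_measure_iInter_atTop (μ := μ) (s := fun k : ℕ => {x | (k : ℝ) < f x})
        (fun k => (measurableSet_lt measurable_const hf).nullMeasurableSet)
        (fun i j hij x (hx : (j : ℝ) < f x) =>
          show (i : ℝ) < f x from lt_of_le_of_lt (Nat.cast_le.2 hij) hx) ⟨0, measure_ne_top _ _⟩
      have he : ⋂ k : ℕ, {x | (k : ℝ) < f x} = ∅ := by
        ext x
        simp only [mem_iInter, mem_ofPred_eq, mem_empty_iff_false, iff_false, not_forall, not_lt]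
        exact exists_nat_ge (f x)
      rwa [he, measure_empty] at this
    obtain ⟨k, hk⟩ := (h1.eventually (ge_mem_nhds (ENNReal.half_pos h0))).exists
    exact ⟨k, hk⟩
  have hbdd : BddBelow S := by
    have h1 : Tendsto (fun k : ℕ => μ {x | -(k : ℝ) < f x}) atTop (𝓝 (μ univ)) := by
      have := tendsto_measure_iUnion_atTop (μ := μ) (s := fun k : ℕ => {x | -(k : ℝ) < f x})
        (fun i j hij x (hx : -(i : ℝ) < f x) =>
          show -(j : ℝ) < f x from lt_of_le_of_lt (neg_le_neg (Nat.cast_le.2 hij)) hx)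
      have he : ⋃ k : ℕ, {x | -(k : ℝ) < f x} = univ := by
        ext x
        simp only [mem_iUnion, mem_ofPred_eq, mem_univ, iff_true]
        obtain ⟨k, hk⟩ := exists_nat_gt (-f x)
        exact ⟨k, by linarith⟩
      rwa [he] at this
    obtain ⟨k, hk⟩ := (h1.eventually (lt_mem_nhds (ENNReal.half_lt_self h0 hV))).exists
    refine ⟨-k, fun t ht => ?_⟩
    by_contra! hlt
    have : μ {x | -(k : ℝ) < f x} ≤ μ {x | t < f x} := measure_mono fun x hx => lt_trans hlt hx
    exact absurd (this.trans ht) (not_le.2 hk)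
  refine ⟨sInf S, ?_, ?_⟩
  · have h1 := tendsto_measure_iUnion_atTop (μ := μ)
      (s := fun k : ℕ => {x | sInf S + 1 / ((k : ℝ) + 1) < f x})
      (fun i j hij x (hx : _ < f x) => show _ < f x from
        lt_of_le_of_lt (add_le_add le_rfl (Nat.one_div_le_one_div hij)) hx)
    have he : ⋃ k : ℕ, {x | sInf S + 1 / ((k : ℝ) + 1) < f x} = {x | sInf S < f x} := by
      ext x
      simp only [mem_iUnion, mem_ofPred_eq]
      constructor
      · rintro ⟨k, hk⟩
        have : (0 : ℝ) < 1 / ((k : ℝ) + 1) := Nat.one_div_pos_of_nat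
        linarith
      · intro h
        obtain ⟨k, hk⟩ := exists_nat_one_div_lt (sub_pos.2 h)
        exact ⟨k, by linarith⟩
    rw [he] at h1
    refine le_of_tendsto' h1 fun k => ?_
    have hlt : sInf S < sInf S + 1 / ((k : ℝ) + 1) := by
      have : (0 : ℝ) < 1 / ((k : ℝ) + 1) := Nat.one_div_pos_of_nat
      linarith
    obtain ⟨t, ht, htlt⟩ := exists_lt_of_csInf_lt hne hlt
    exact (measure_mono fun x hx => lt_trans htlt hx).trans ht
  · have h1 := tendsto_measure_iUnion_atTop (μ := μ)
      (s := fun k : ℕ => {x | f x ≤ sInf S - 1 / ((k : ℝ) + 1)})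
      (fun i j hij x (hx : f x ≤ _) => show f x ≤ _ from
        le_trans hx (sub_le_sub le_rfl (Nat.one_div_le_one_div hij)))
    have he : ⋃ k : ℕ, {x | f x ≤ sInf S - 1 / ((k : ℝ) + 1)} = {x | f x < sInf S} := by
      ext x
      simp only [mem_iUnion, mem_ofPred_eq]
      constructor
      · rintro ⟨k, hk⟩
        have : (0 : ℝ) < 1 / ((k : ℝ) + 1) := Nat.one_div_pos_of_nat
        linarith
      · intro h
        obtain ⟨k, hk⟩ := exists_nat_one_div_lt (sub_pos.2 h)
        exact ⟨k, by linarith⟩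
    rw [he] at h1
    refine le_of_tendsto' h1 fun k => ?_
    set t := sInf S - 1 / ((k : ℝ) + 1)
    have hlt : t < sInf S := by
      have : (0 : ℝ) < 1 / ((k : ℝ) + 1) := Nat.one_div_pos_of_nat
      simp only [t]; linarith
    have hnt : t ∉ S := notMem_of_lt_csInf hlt hbdd
    have hgt : μ univ / 2 < μ {x | t < f x} := not_le.1 hnt
    have hc : {x | f x ≤ t} = {x | t < f x}ᶜ := by ext x; simp
    change μ {x | f x ≤ t} ≤ _
    rw [hc, measure_compl (measurableSet_lt measurable_const hf) (measure_ne_top _ _)]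
    calc μ univ - μ {x | t < f x} ≤ μ univ - μ univ / 2 := tsub_le_tsub_left hgt.le _
      _ = μ univ / 2 := ENNReal.sub_half hV

end Median

/-! ### One-dimensional inequalities for distribution functions -/

section Absorption

/-- For a nonincreasing `N` vanishing at infinity, `∫ t^(p-1) N(t)^(1-θ)` is controlled by
`∫ t^(p-1) N(2t) N(t)^(-θ)`. -/
theorem exists_lintegral_rpow_le_of_antitone {p θ : ℝ} (hp : 1 ≤ p) (hθ0 : 0 < θ) (hθ1 : θ < 1) :
    ∃ C : ℝ≥0∞, C ≠ ⊤ ∧ ∀ (N : ℝ → ℝ≥0∞), Antitone N → (∀ t, N t ≠ ⊤) → (∃ M, ∀ t, M ≤ t → N t = 0) →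
      ∫⁻ t in Ioi (0 : ℝ), ENNReal.ofReal (t ^ (p - 1)) * N t ^ (1 - θ) ≤
        C * ∫⁻ t in Ioi (0 : ℝ), ENNReal.ofReal (t ^ (p - 1)) * (N (2 * t) * N t ^ (-θ)) := by
  have hθ : 0 < 1 - θ := by linarith
  -- Chosen so that `δ^(1-θ) = 2^(-p-1)`: the substitution `t ↦ 2t` costs `2^p`, which leaves the
  -- factor one half needed for absorption.
  set δ : ℝ≥0∞ := ((2 : ℝ≥0∞) ^ (-p - 1)) ^ (1 / (1 - θ)) with hδ
  have hδ0 : δ ≠ 0 := by simp [hδ, ENNReal.rpow_eq_zero_iff]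
  have hδt : δ ≠ ⊤ := by simp [hδ, ENNReal.rpow_eq_top_iff]
  have hδe : δ ^ (1 - θ) = 2 ^ (-p - 1) := by
    rw [hδ, ← ENNReal.rpow_mul, one_div, inv_mul_cancel₀ hθ.ne', ENNReal.rpow_one]
  have h2 : ∀ a : ℝ, (2 : ℝ≥0∞) ^ a ≠ ⊤ := fun a => by simp [ENNReal.rpow_eq_top_iff]
  have hK : δ ^ (-θ) ≠ ⊤ := by simp [ENNReal.rpow_eq_top_iff, hδ0, hδt]
  refine ⟨2 * (2 ^ p * δ ^ (-θ)), ENNReal.mul_ne_top (by simp) (ENNReal.mul_ne_top (h2 _) hK), ?_⟩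
  rintro N hN hNt ⟨M, hM⟩
  have hNm : Measurable N := hN.measurable
  set I := ∫⁻ t in Ioi (0 : ℝ), ENNReal.ofReal (t ^ (p - 1)) * N t ^ (1 - θ) with hI
  set X := ∫⁻ t in Ioi (0 : ℝ), ENNReal.ofReal (t ^ (p - 1)) * (N (2 * t) * N t ^ (-θ)) with hX
  -- Subtracting `I / 2` from both sides at the end requires `I` finite; this is where the vanishing
  -- of `N` beyond `M` enters.
  have hIfin : I ≠ ⊤ := by
    have hle : I ≤ ∫⁻ t in Ioo (0 : ℝ) M, ENNReal.ofReal (M ^ (p - 1)) * N 0 ^ (1 - θ) := by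
      rw [hI, ← lintegral_indicator measurableSet_Ioi, ← lintegral_indicator measurableSet_Ioo]
      refine lintegral_mono fun t => ?_
      by_cases ht : t ∈ Ioo (0 : ℝ) M
      · rw [indicator_of_mem ht, indicator_of_mem (show t ∈ Ioi 0 from ht.1)]
        gcongr
        · exact ht.1.le
        · exact ht.2.le
        · exact hN ht.1.le
      · rw [indicator_of_notMem ht]
        by_cases ht0 : t ∈ Ioi (0 : ℝ)
        · have htM : M ≤ t := by
            by_contra! h; exact ht ⟨ht0, h⟩
          rw [indicator_of_mem ht0, hM t htM, ENNReal.zero_rpow_of_pos hθ, mul_zero]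
        · rw [indicator_of_notMem ht0]
    refine ne_top_of_le_ne_top ?_ hle
    rw [setLIntegral_const]
    refine ENNReal.mul_ne_top (ENNReal.mul_ne_top ENNReal.ofReal_ne_top
      (ENNReal.rpow_ne_top_of_nonneg hθ.le (hNt 0))) (by simp)
  -- Dichotomy: either `N` drops by at most the factor `δ` from `t` to `2t`, and the negative powers
  -- are comparable, or it drops by more, and the term is small enough to absorb.
  have hpt : ∀ t : ℝ, 0 < t → N (2 * t) ^ (1 - θ) ≤
      δ ^ (-θ) * (N (2 * t) * N t ^ (-θ)) + 2 ^ (-p - 1) * N t ^ (1 - θ) := by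
    intro t ht
    rcases le_total (δ * N t) (N (2 * t)) with h | h
    · refine le_add_right ?_
      rcases eq_or_ne (N (2 * t)) 0 with h0 | h0
      · rw [h0, ENNReal.zero_rpow_of_pos hθ]; exact bot_le
      have e : N (2 * t) ^ (1 - θ) = N (2 * t) * N (2 * t) ^ (-θ) := by
        rw [sub_eq_add_neg, ENNReal.rpow_add _ _ h0 (hNt _), ENNReal.rpow_one]
      have hle : N (2 * t) ^ (-θ) ≤ (δ * N t) ^ (-θ) := by
        rw [ENNReal.rpow_neg, ENNReal.rpow_neg]
        exact ENNReal.inv_le_inv.2 (ENNReal.rpow_le_rpow h hθ0.le)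
      rw [ENNReal.mul_rpow_of_ne_top hδt (hNt _)] at hle
      rw [e]
      calc _ ≤ N (2 * t) * (δ ^ (-θ) * N t ^ (-θ)) := by gcongr
        _ = _ := by ring
    · refine le_add_left ?_
      rw [← hδe, ← ENNReal.mul_rpow_of_nonneg _ _ hθ.le]
      exact ENNReal.rpow_le_rpow h hθ.le
  have hscale : I = 2 ^ p * ∫⁻ t in Ioi (0 : ℝ), ENNReal.ofReal (t ^ (p - 1)) *
      N (2 * t) ^ (1 - θ) := by
    rw [hI, ← lintegral_indicator measurableSet_Ioi, ← lintegral_indicator measurableSet_Ioi,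
      lintegral_comp_smul_eq (volume : Measure ℝ) two_pos]
    have e : ∀ t : ℝ, (Ioi (0 : ℝ)).indicator
        (fun t => ENNReal.ofReal (t ^ (p - 1)) * N t ^ (1 - θ)) ((2 : ℝ) • t) =
        2 ^ (p - 1) * (Ioi (0 : ℝ)).indicator
          (fun t => ENNReal.ofReal (t ^ (p - 1)) * N (2 * t) ^ (1 - θ)) t := by
      intro t
      by_cases ht : t ∈ Ioi (0 : ℝ)
      · have ht' : (2 : ℝ) • t ∈ Ioi (0 : ℝ) := by
          simp only [mem_Ioi, smul_eq_mul] at ht ⊢; linarith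
        rw [indicator_of_mem ht, indicator_of_mem ht', smul_eq_mul,
          Real.mul_rpow (by norm_num) (le_of_lt ht), ENNReal.ofReal_mul (by positivity),
          ← ENNReal.ofReal_rpow_of_pos two_pos]
        simp only [ENNReal.ofReal_ofNat]
        ring
      · have ht' : (2 : ℝ) • t ∉ Ioi (0 : ℝ) := by
          simp only [mem_Ioi, smul_eq_mul, not_lt] at ht ⊢; linarith
        rw [indicator_of_notMem ht, indicator_of_notMem ht', mul_zero]
    simp_rw [e]
    rw [lintegral_const_mul' _ _ (h2 _), ← mul_assoc]
    congr 1
    simp only [Module.finrank_self, Nat.cast_one, ENNReal.rpow_one, ENNReal.ofReal_ofNat]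
    nth_rewrite 1 [← ENNReal.rpow_one 2]
    rw [← ENNReal.rpow_add _ _ (by simp) (by simp)]
    congr 1
    ring
  have hkey : I ≤ 2 ^ p * (δ ^ (-θ) * X) + I / 2 := by
    calc I = 2 ^ p * ∫⁻ t in Ioi (0 : ℝ), ENNReal.ofReal (t ^ (p - 1)) *
          N (2 * t) ^ (1 - θ) := hscale
      _ ≤ 2 ^ p * ∫⁻ t in Ioi (0 : ℝ),
          (δ ^ (-θ) * (ENNReal.ofReal (t ^ (p - 1)) * (N (2 * t) * N t ^ (-θ))) +
          2 ^ (-p - 1) * (ENNReal.ofReal (t ^ (p - 1)) * N t ^ (1 - θ))) := by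
          refine mul_le_mul_right (setLIntegral_mono' measurableSet_Ioi fun t ht => ?_) _
          refine (mul_le_mul_right (hpt t ht) _).trans (le_of_eq ?_)
          ring
      _ = 2 ^ p * (δ ^ (-θ) * X) + I / 2 := by
          rw [lintegral_add_right _ (by fun_prop), lintegral_const_mul' _ _ hK,
            lintegral_const_mul' _ _ (h2 _), ← hX, ← hI, mul_add, ← mul_assoc (2 ^ p) (2 ^ (-p - 1)),
            ← ENNReal.rpow_add _ _ (by simp) (by simp), show p + (-p - 1) = -1 by ring,
            ENNReal.rpow_neg_one, mul_comm _ I, div_eq_mul_inv]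
  have hhalf : I / 2 ≤ 2 ^ p * (δ ^ (-θ) * X) := by
    have h3 : I / 2 + I / 2 ≤ 2 ^ p * (δ ^ (-θ) * X) + I / 2 := by rwa [ENNReal.add_halves]
    exact (ENNReal.add_le_add_iff_right (ENNReal.div_ne_top hIfin (by simp))).1 h3
  calc I = 2 * (I / 2) := (ENNReal.mul_div_cancel (by simp) (by simp)).symm
    _ ≤ 2 * (2 ^ p * (δ ^ (-θ) * X)) := by gcongr
    _ = _ := by ring

/-- The embedding of the Lorentz space `L^{q,p}` into `L^q` for `p < q`, in terms of the
distribution function `N`, with `p / q = 1 - θ`. -/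
theorem lintegral_mul_rpow_le_of_antitone {p q θ : ℝ} (hp : 1 ≤ p) (hpq : p ≤ q)
    (hθ : 1 - θ = p / q) {N : ℝ → ℝ≥0∞} (hN : Antitone N) :
    ∫⁻ t in Ioi (0 : ℝ), N t * ENNReal.ofReal (t ^ (q - 1)) ≤
      (2 ^ p * ∫⁻ t in Ioi (0 : ℝ), ENNReal.ofReal (t ^ (p - 1)) * N t ^ (1 - θ)) ^ (q / p) := by
  have hp0 : 0 < p := by linarith
  have hq0 : 0 < q := by linarith
  have hθ' : 0 < 1 - θ := by rw [hθ]; positivity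
  set I := ∫⁻ t in Ioi (0 : ℝ), ENNReal.ofReal (t ^ (p - 1)) * N t ^ (1 - θ) with hI
  have hNm : Measurable N := hN.measurable
  have h2p : (1 : ℝ≥0∞) ≤ 2 ^ p := by
    have := ENNReal.rpow_le_rpow (show (1 : ℝ≥0∞) ≤ 2 by norm_num) hp0.le
    simpa using this
  -- The weak-type bound, read off from the interval `(t/2, t]` by monotonicity. Its power `q/p - 1`
  -- is then taken out of `N t · t^(q-1) = (t^(p-1) N^(1-θ)) · (t^p N^(1-θ))^(q/p-1)`.
  have hweak : ∀ t : ℝ, 0 < t → ENNReal.ofReal (t ^ p) * N t ^ (1 - θ) ≤ 2 ^ p * I := by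
    intro t ht
    have h1 : ENNReal.ofReal ((t / 2) ^ p) * N t ^ (1 - θ) ≤ I := by
      calc ENNReal.ofReal ((t / 2) ^ p) * N t ^ (1 - θ)
          = ∫⁻ _ in Ioc (t / 2) t, ENNReal.ofReal ((t / 2) ^ (p - 1)) * N t ^ (1 - θ) := by
            rw [setLIntegral_const, Real.volume_Ioc, show t - t / 2 = t / 2 by ring,
              mul_right_comm, ← ENNReal.ofReal_mul (by positivity)]
            congr 2
            rw [← Real.rpow_add_one (by positivity)]
            congr 1
            ring
        _ ≤ ∫⁻ τ in Ioc (t / 2) t, ENNReal.ofReal (τ ^ (p - 1)) * N τ ^ (1 - θ) := by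
            refine setLIntegral_mono' measurableSet_Ioc fun τ hτ => ?_
            gcongr
            · exact hτ.1.le
            · exact hN hτ.2
        _ ≤ I := lintegral_mono_set fun τ hτ => lt_trans (by positivity) hτ.1
    calc ENNReal.ofReal (t ^ p) * N t ^ (1 - θ)
        = 2 ^ p * (ENNReal.ofReal ((t / 2) ^ p) * N t ^ (1 - θ)) := by
          rw [← mul_assoc]
          congr 1
          rw [show (2 : ℝ≥0∞) ^ p = ENNReal.ofReal (2 ^ p) by
            rw [← ENNReal.ofReal_rpow_of_pos two_pos]; simp,
            ← ENNReal.ofReal_mul (by positivity), ← Real.mul_rpow (by norm_num) (by positivity)]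
          congr 2
          ring
      _ ≤ 2 ^ p * I := by gcongr
  have hexp : 0 ≤ q / p - 1 := by rw [sub_nonneg, one_le_div hp0]; exact hpq
  calc ∫⁻ t in Ioi (0 : ℝ), N t * ENNReal.ofReal (t ^ (q - 1))
      ≤ ∫⁻ t in Ioi (0 : ℝ), (ENNReal.ofReal (t ^ (p - 1)) * N t ^ (1 - θ)) *
          (2 ^ p * I) ^ (q / p - 1) := by
        refine setLIntegral_mono' measurableSet_Ioi fun t ht => ?_
        have ht0 : (0 : ℝ) < t := ht
        refine le_trans (le_of_eq ?_)
          (mul_le_mul_right (ENNReal.rpow_le_rpow (hweak t ht) hexp) _)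
        rw [ENNReal.mul_rpow_of_nonneg _ _ hexp, mul_mul_mul_comm, ← ENNReal.rpow_mul,
          ← ENNReal.rpow_add_of_nonneg _ _ hθ'.le (by positivity),
          ENNReal.ofReal_rpow_of_pos (by positivity), ← ENNReal.ofReal_mul (by positivity),
          ← Real.rpow_mul ht0.le, ← Real.rpow_add ht0, mul_comm]
        congr 2
        · congr 1
          field_simp
          ring
        · rw [hθ]
          have : p / q + p / q * (q / p - 1) = 1 := by field_simp; ring
          rw [this, ENNReal.rpow_one]
    _ = I * (2 ^ p * I) ^ (q / p - 1) := by rw [lintegral_mul_const _ (by fun_prop)]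
    _ ≤ (2 ^ p * I) * (2 ^ p * I) ^ (q / p - 1) := by
        gcongr
        exact le_mul_of_one_le_left' h2p
    _ = (2 ^ p * I) ^ (q / p) := by
        nth_rewrite 1 [← ENNReal.rpow_one (2 ^ p * I)]
        rw [← ENNReal.rpow_add_of_nonneg _ _ zero_le_one hexp]
        congr 1
        ring

end Absorption

/-! ### Energy controls the superlevel sets -/

section Sobolev
variable {n : ℕ}
local notation "𝔼" => EuclideanSpace ℝ (Fin n)

/-- Moving from `x` towards the centre by the fraction `ρ / (2r)` of the way leaves room for a ball
of radius `ρ / 2`. So balls satisfy a measure density condition up to their boundary. -/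
theorem exists_ball_subset_ball_inter_closedBall {x₀ x : 𝔼} {r ρ : ℝ}
    (hx : x ∈ Metric.ball x₀ r) (hρ : 0 ≤ ρ) (hρr : ρ ≤ 2 * r) :
    ∃ z : 𝔼, Metric.ball z (ρ / 2) ⊆ Metric.ball x₀ r ∩ Metric.closedBall x ρ := by
  have hxr : ‖x - x₀‖ < r := mem_ball_iff_norm.1 hx
  have hr : 0 < r := (norm_nonneg _).trans_lt hxr
  set t : ℝ := ρ / (2 * r) with ht
  have ht0 : 0 ≤ t := by positivity
  have ht1 : t ≤ 1 := by rw [ht, div_le_one (by positivity)]; exact hρr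
  have htr : t * r = ρ / 2 := by rw [ht]; field_simp
  refine ⟨x + t • (x₀ - x), fun y hy => ?_⟩
  rw [mem_ball_iff_norm] at hy
  constructor
  · rw [mem_ball_iff_norm]
    have e : y - x₀ = (y - (x + t • (x₀ - x))) + (1 - t) • (x - x₀) := by module
    rw [e]
    calc _ ≤ ‖y - (x + t • (x₀ - x))‖ + ‖(1 - t) • (x - x₀)‖ := norm_add_le _ _
      _ = ‖y - (x + t • (x₀ - x))‖ + (1 - t) * ‖x - x₀‖ := by
        rw [norm_smul, Real.norm_of_nonneg (sub_nonneg.2 ht1)]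
      _ < ρ / 2 + (1 - t) * r := by
        refine add_lt_add_of_lt_of_le hy ?_
        exact mul_le_mul_of_nonneg_left hxr.le (sub_nonneg.2 ht1)
      _ = r := by rw [sub_mul, htr]; ring
  · rw [mem_closedBall_iff_norm]
    have e : y - x = (y - (x + t • (x₀ - x))) + t • (x₀ - x) := by module
    rw [e]
    calc _ ≤ ‖y - (x + t • (x₀ - x))‖ + ‖t • (x₀ - x)‖ := norm_add_le _ _
      _ = ‖y - (x + t • (x₀ - x))‖ + t * ‖x - x₀‖ := by
        rw [norm_smul, Real.norm_of_nonneg ht0, norm_sub_rev x₀]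
      _ ≤ ρ / 2 + t * r := by
        refine add_le_add hy.le ?_
        exact mul_le_mul_of_nonneg_left hxr.le ht0
      _ = ρ := by rw [htr]; ring

/-- Near any point of the ball, at the length scale set by the volume of `S`, the complement of `S`
still has volume at least that of `S`; the kernel is bounded below at that scale. -/
theorem exists_le_lintegral_kernel_diff (hn : 1 ≤ n) {Q : ℝ} (hQ : 0 ≤ Q) :
    ∃ c : ℝ≥0∞, c ≠ 0 ∧ c ≠ ⊤ ∧ ∀ (x₀ : 𝔼) (r : ℝ), ∀ x ∈ Metric.ball x₀ r,
      ∀ S : Set 𝔼, MeasurableSet S →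
      volume (Metric.ball x₀ r ∩ S) ≤ volume (Metric.ball x₀ r) / 2 →
      volume (Metric.ball x₀ r ∩ S) ≠ 0 →
      c * volume (Metric.ball x₀ r ∩ S) ^ (1 - Q / n) ≤
        ∫⁻ y in Metric.ball x₀ r \ S, (‖x - y‖ₑ ^ Q)⁻¹ := by
  have hn0 : (0 : ℝ) < n := by exact_mod_cast hn
  set w : ℝ≥0∞ := volume (Metric.ball (0 : 𝔼) 1) with hw
  have hw0 : w ≠ 0 := (Metric.measure_ball_pos volume _ one_pos).ne'
  have hwt : w ≠ ⊤ := measure_ball_lt_top.ne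
  have hvol : ∀ (z : 𝔼) {ρ : ℝ}, 0 < ρ → volume (Metric.ball z ρ) = ENNReal.ofReal ρ ^ (n : ℝ) * w := by
    intro z ρ hρ
    rw [Measure.addHaar_ball_of_pos _ _ hρ, finrank_euclideanSpace, Fintype.card_fin,
      ENNReal.rpow_natCast, ENNReal.ofReal_pow hρ.le]
  have hd0 : 2 / w ≠ 0 := ENNReal.div_ne_zero.2 ⟨by simp, hwt⟩
  have hdt : 2 / w ≠ ⊤ := ENNReal.div_ne_top (by simp) hw0
  have hKt : (2 : ℝ≥0∞) ^ Q * (2 / w) ^ (Q / n) ≠ ⊤ :=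
    ENNReal.mul_ne_top (ENNReal.rpow_ne_top_of_nonneg hQ (by simp))
      (ENNReal.rpow_ne_top_of_nonneg (by positivity) hdt)
  have hK0 : (2 : ℝ≥0∞) ^ Q * (2 / w) ^ (Q / n) ≠ 0 :=
    mul_ne_zero (ENNReal.rpow_pos (by simp) (by simp)).ne'
      (ENNReal.rpow_pos (pos_iff_ne_zero.2 hd0) hdt).ne'
  refine ⟨(2 ^ Q * (2 / w) ^ (Q / n))⁻¹, ENNReal.inv_ne_zero.2 hKt, ENNReal.inv_ne_top.2 hK0, ?_⟩
  intro x₀ r x hx S hS hV hV0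
  set V := volume (Metric.ball x₀ r ∩ S) with hVdef
  have hVt : V ≠ ⊤ := ((measure_mono inter_subset_left).trans_lt measure_ball_lt_top).ne
  have hr : 0 < r := Metric.pos_of_mem_ball hx
  -- The radius of a ball with twice the volume `V`. The half-volume hypothesis says exactly that
  -- `R` does not exceed `r`.
  set R : ℝ≥0∞ := (2 / w * V) ^ (1 / (n : ℝ)) with hR
  have hRt : R ≠ ⊤ := ENNReal.rpow_ne_top_of_nonneg (by positivity) (ENNReal.mul_ne_top hdt hVt)
  have hR0 : R ≠ 0 := by
    rw [hR, Ne, ENNReal.rpow_eq_zero_iff_of_pos (by positivity)]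
    exact mul_ne_zero hd0 hV0
  have hRn : R ^ (n : ℝ) * w = 2 * V := by
    rw [hR, ← ENNReal.rpow_mul, one_div, inv_mul_cancel₀ hn0.ne', ENNReal.rpow_one, mul_right_comm,
      ENNReal.div_mul_cancel hw0 hwt]
  have hRr : R ≤ ENNReal.ofReal r := by
    refine (ENNReal.rpow_le_rpow_iff hn0).1 ?_
    refine (ENNReal.mul_le_mul_iff_left hw0 hwt).1 ?_
    rw [hRn, ← hvol x₀ hr]
    calc 2 * V ≤ 2 * (volume (Metric.ball x₀ r) / 2) := by gcongr
      _ = _ := ENNReal.mul_div_cancel (by simp) (by simp)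
  set ρ : ℝ := 2 * R.toReal with hρ
  have hρ0 : 0 < R.toReal := ENNReal.toReal_pos hR0 hRt
  obtain ⟨z, hz⟩ := exists_ball_subset_ball_inter_closedBall (ρ := ρ) hx (by positivity)
    (by rw [hρ]; gcongr; exact ENNReal.toReal_le_of_le_ofReal hr.le hRr)
  have hzvol : volume (Metric.ball z (ρ / 2)) = 2 * V := by
    rw [hvol z (by positivity), hρ, mul_div_cancel_left₀ _ two_ne_zero, ENNReal.ofReal_toReal hRt,
      hRn]
  have hdiff : V ≤ volume (Metric.ball z (ρ / 2) \ S) := by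
    have h1 := measure_inter_add_sdiff (μ := volume) (Metric.ball z (ρ / 2)) hS
    have h2 : volume (Metric.ball z (ρ / 2) ∩ S) ≤ V :=
      measure_mono (inter_subset_inter_left _ fun y hy => (hz hy).1)
    rw [hzvol, two_mul] at h1
    refine (ENNReal.add_le_add_iff_left hVt).1 (h1.symm.trans_le ?_)
    gcongr
  have hrho : ENNReal.ofReal ρ = 2 * R := by
    rw [hρ, ENNReal.ofReal_mul (by norm_num), ENNReal.ofReal_toReal hRt]; simp
  have hRQ : (2 * R) ^ Q = 2 ^ Q * (2 / w) ^ (Q / n) * V ^ (Q / n) := by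
    rw [ENNReal.mul_rpow_of_nonneg _ _ hQ, hR, ← ENNReal.rpow_mul, mul_assoc,
      ← ENNReal.mul_rpow_of_nonneg _ _ (by positivity)]
    congr 2
    ring
  calc (2 ^ Q * (2 / w) ^ (Q / n))⁻¹ * V ^ (1 - Q / n)
      = ((2 * R) ^ Q)⁻¹ * V := by
        rw [hRQ, ENNReal.rpow_sub _ _ hV0 hVt, ENNReal.rpow_one,
          ENNReal.mul_inv (Or.inl hK0) (Or.inl hKt), mul_assoc]
        congr 1
        rw [ENNReal.div_eq_inv_mul]
    _ ≤ ((2 * R) ^ Q)⁻¹ * volume (Metric.ball z (ρ / 2) \ S) := by gcongr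
    _ = ∫⁻ _ in Metric.ball z (ρ / 2) \ S, ((2 * R) ^ Q)⁻¹ := (setLIntegral_const _ _).symm
    _ ≤ ∫⁻ y in Metric.ball z (ρ / 2) \ S, (‖x - y‖ₑ ^ Q)⁻¹ := by
        refine setLIntegral_mono' (Metric.isOpen_ball.measurableSet.diff hS) fun y hy => ?_
        rw [ENNReal.inv_le_inv]
        refine ENNReal.rpow_le_rpow ?_ hQ
        rw [← hrho, ← ofReal_norm, ← dist_eq_norm, dist_comm]
        exact ENNReal.ofReal_le_ofReal (hz hy.1).2
    _ ≤ _ := lintegral_mono_set (sdiff_subset_sdiff_left fun y hy => (hz hy).1)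

theorem lintegral_Ioo_rpow_le {p : ℝ} (hp : 1 ≤ p) (D : ℝ) :
    ∫⁻ t in Ioo (0 : ℝ) D, ENNReal.ofReal (t ^ (p - 1)) ≤ ENNReal.ofReal D ^ p := by
  rcases le_or_gt D 0 with hD | hD
  · simp [Ioo_eq_empty (not_lt.2 hD)]
  calc ∫⁻ t in Ioo (0 : ℝ) D, ENNReal.ofReal (t ^ (p - 1))
      ≤ ∫⁻ _ in Ioo (0 : ℝ) D, ENNReal.ofReal (D ^ (p - 1)) := by
        refine setLIntegral_mono' measurableSet_Ioo fun t ht => ENNReal.ofReal_le_ofReal ?_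
        exact Real.rpow_le_rpow ht.1.le ht.2.le (by linarith)
    _ = ENNReal.ofReal D ^ p := by
        rw [setLIntegral_const, Real.volume_Ioo, sub_zero, ← ENNReal.ofReal_mul (by positivity),
          ENNReal.ofReal_rpow_of_pos hD]
        congr 1
        rw [← Real.rpow_add_one hD.ne']
        congr 1
        ring

/-- For each level `t`, the interaction of `{f > 2t}` with `{f ≤ t}` is bounded below through the
kernel estimate. Integrating against `t^(p-1)` and exchanging integrals, a pair `(x, y)` is counted
only for `t < f x - f y`, which gives at most the energy density. -/
theorem exists_lintegral_superlevel_le (hn : 1 ≤ n) {s p : ℝ} (hs0 : 0 < s) (hp : 1 ≤ p) :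
    ∃ C : ℝ≥0∞, C ≠ ⊤ ∧ ∀ (x₀ : 𝔼) (r : ℝ) (f : 𝔼 → ℝ), Measurable f →
      volume (Metric.ball x₀ r ∩ {x | 0 < f x}) ≤ volume (Metric.ball x₀ r) / 2 →
      ∫⁻ t in Ioi (0 : ℝ), ENNReal.ofReal (t ^ (p - 1)) *
        (volume (Metric.ball x₀ r ∩ {x | 2 * t < f x}) *
          volume (Metric.ball x₀ r ∩ {x | t < f x}) ^ (-(s * p / n))) ≤
        C * gagliardoPow s p (Metric.ball x₀ r) f := by
  have hn0 : (0 : ℝ) < n := by exact_mod_cast hn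
  obtain ⟨c, hc0, hc_top, hc⟩ := exists_le_lintegral_kernel_diff (n := n) hn (Q := n + s * p)
    (by positivity)
  refine ⟨c⁻¹, by simpa using hc0, fun x₀ r f hf hhalf => ?_⟩
  set B := Metric.ball x₀ r with hBdef
  have hB : MeasurableSet B := Metric.isOpen_ball.measurableSet
  set Q : ℝ := n + s * p with hQ
  have hQe : 1 - Q / n = -(s * p / n) := by rw [hQ]; field_simp; ring
  have hmS : ∀ t : ℝ, MeasurableSet {x | t < f x} := fun t => measurableSet_lt measurable_const hf
  set T : Set (ℝ × 𝔼 × 𝔼) := {z | 0 < z.1 ∧ 2 * z.1 < f z.2.1 ∧ f z.2.2 ≤ z.1} with hT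
  have hTm : MeasurableSet T := by
    have h1 : Measurable fun z : ℝ × 𝔼 × 𝔼 => 2 * z.1 := by fun_prop
    have h2 : Measurable fun z : ℝ × 𝔼 × 𝔼 => f z.2.1 := by fun_prop
    have h3 : Measurable fun z : ℝ × 𝔼 × 𝔼 => f z.2.2 := by fun_prop
    exact (measurableSet_lt measurable_const measurable_fst).inter
      ((measurableSet_lt h1 h2).inter (measurableSet_le h3 measurable_fst))
  set F : ℝ × 𝔼 × 𝔼 → ℝ≥0∞ := T.indicator
    (fun z => ENNReal.ofReal (z.1 ^ (p - 1)) * (‖z.2.1 - z.2.2‖ₑ ^ Q)⁻¹) with hF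
  have hFm : Measurable F := Measurable.indicator (by fun_prop) hTm
  have hlow : ∀ t ∈ Ioi (0 : ℝ), ENNReal.ofReal (t ^ (p - 1)) *
      (volume (B ∩ {x | 2 * t < f x}) * volume (B ∩ {x | t < f x}) ^ (-(s * p / n))) ≤
      c⁻¹ * ∫⁻ x in B, ∫⁻ y in B, F (t, x, y) := by
    intro t ht
    have ht0 : (0 : ℝ) < t := ht
    set V := volume (B ∩ {x | t < f x}) with hV
    have hsub : volume (B ∩ {x | 2 * t < f x}) ≤ V :=
      measure_mono (inter_subset_inter_right _ fun x (hx : 2 * t < f x) =>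
        show t < f x by linarith)
    -- The negative power of `V` is `⊤` here, but it is multiplied by the volume of the smaller set,
    -- which is zero.
    rcases eq_or_ne V 0 with h0 | h0
    · rw [h0, nonpos_iff_eq_zero] at hsub
      rw [hsub]; simp
    have hVh : V ≤ volume B / 2 := le_trans
      (measure_mono (inter_subset_inter_right _ fun x (hx : t < f x) => ht0.trans hx)) hhalf
    have hx : ∀ x ∈ B ∩ {x | 2 * t < f x},
        ENNReal.ofReal (t ^ (p - 1)) * (c * V ^ (-(s * p / n))) ≤ ∫⁻ y in B, F (t, x, y) := by
      intro x hx
      have h1 := hc x₀ r x hx.1 _ (hmS t) hVh h0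
      rw [hQe] at h1
      calc _ ≤ ENNReal.ofReal (t ^ (p - 1)) * ∫⁻ y in B \ {x | t < f x}, (‖x - y‖ₑ ^ Q)⁻¹ := by
            gcongr
        _ = ∫⁻ y in B \ {x | t < f x}, ENNReal.ofReal (t ^ (p - 1)) * (‖x - y‖ₑ ^ Q)⁻¹ :=
            (lintegral_const_mul' _ _ ENNReal.ofReal_ne_top).symm
        _ = ∫⁻ y in B \ {x | t < f x}, F (t, x, y) := by
            refine setLIntegral_congr_fun (hB.diff (hmS t)) fun y hy => ?_
            have : (t, x, y) ∈ T := ⟨ht0, hx.2, not_lt.1 hy.2⟩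
            simp only [hF, indicator_of_mem this]
        _ ≤ _ := lintegral_mono_set sdiff_subset
    have hint : ENNReal.ofReal (t ^ (p - 1)) * (c * V ^ (-(s * p / n))) *
        volume (B ∩ {x | 2 * t < f x}) ≤ ∫⁻ x in B, ∫⁻ y in B, F (t, x, y) := by
      rw [← setLIntegral_const]
      exact (setLIntegral_mono' (hB.inter (hmS _)) hx).trans (lintegral_mono_set inter_subset_left)
    calc _ = c⁻¹ * (ENNReal.ofReal (t ^ (p - 1)) * (c * V ^ (-(s * p / n))) *
        volume (B ∩ {x | 2 * t < f x})) := by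
          rw [show c⁻¹ * (ENNReal.ofReal (t ^ (p - 1)) * (c * V ^ (-(s * p / n))) *
            volume (B ∩ {x | 2 * t < f x})) = (c⁻¹ * c) * (ENNReal.ofReal (t ^ (p - 1)) *
            (V ^ (-(s * p / n)) * volume (B ∩ {x | 2 * t < f x}))) by ring,
            ENNReal.inv_mul_cancel hc0 hc_top, one_mul, mul_comm (V ^ _)]
      _ ≤ _ := by gcongr
  have hinner : ∀ x y : 𝔼, ∫⁻ t, F (t, x, y) ≤ ‖f x - f y‖ₑ ^ p / ‖x - y‖ₑ ^ Q := by
    intro x y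
    calc ∫⁻ t, F (t, x, y)
        ≤ ∫⁻ t in Ioo (0 : ℝ) (f x - f y), ENNReal.ofReal (t ^ (p - 1)) * (‖x - y‖ₑ ^ Q)⁻¹ := by
          rw [← lintegral_indicator measurableSet_Ioo]
          refine lintegral_mono fun t => ?_
          by_cases h : (t, x, y) ∈ T
          · obtain ⟨h1, h2, h3⟩ := id h
            simp only at h1 h2 h3
            have : t ∈ Ioo (0 : ℝ) (f x - f y) := ⟨h1, by linarith⟩
            simp only [hF, indicator_of_mem h, indicator_of_mem this]
            exact le_rfl
          · simp only [hF, indicator_of_notMem h]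
            exact bot_le
      _ = (∫⁻ t in Ioo (0 : ℝ) (f x - f y), ENNReal.ofReal (t ^ (p - 1))) * (‖x - y‖ₑ ^ Q)⁻¹ :=
          lintegral_mul_const _ (by fun_prop)
      _ ≤ _ := by
          rw [div_eq_mul_inv]
          gcongr
          refine (lintegral_Ioo_rpow_le hp _).trans (ENNReal.rpow_le_rpow ?_ (by linarith))
          rw [← ofReal_norm]
          exact ENNReal.ofReal_le_ofReal (le_abs_self _)
  have hm1 : Measurable fun z : ℝ × 𝔼 => ∫⁻ y in B, F (z.1, z.2, y) := by
    have : Measurable fun z : (ℝ × 𝔼) × 𝔼 => F (z.1.1, z.1.2, z.2) :=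
      hFm.comp (by fun_prop)
    exact this.lintegral_prod_right'
  calc _ ≤ ∫⁻ t in Ioi (0 : ℝ), c⁻¹ * ∫⁻ x in B, ∫⁻ y in B, F (t, x, y) :=
        setLIntegral_mono' measurableSet_Ioi hlow
    _ ≤ ∫⁻ t : ℝ, c⁻¹ * ∫⁻ x in B, ∫⁻ y in B, F (t, x, y) := setLIntegral_le_lintegral _ _
    _ = c⁻¹ * ∫⁻ t : ℝ, ∫⁻ x in B, ∫⁻ y in B, F (t, x, y) :=
        lintegral_const_mul' _ _ (by simpa using hc0)
    _ = c⁻¹ * ∫⁻ x in B, ∫⁻ t : ℝ, ∫⁻ y in B, F (t, x, y) := by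
        rw [lintegral_lintegral_swap hm1.aemeasurable]
    _ = c⁻¹ * ∫⁻ x in B, ∫⁻ y in B, ∫⁻ t : ℝ, F (t, x, y) := by
        congr 1
        refine lintegral_congr fun x => ?_
        have : Measurable fun z : ℝ × 𝔼 => F (z.1, x, z.2) := hFm.comp (by fun_prop)
        rw [lintegral_lintegral_swap this.aemeasurable]
    _ ≤ _ := by
        unfold gagliardoPow
        gcongr with x y
        exact hinner x y

end Sobolev

/-! ### The fractional Sobolev–Poincaré inequality on balls -/

section SobolevPoincare
variable {n : ℕ}
local notation "𝔼" => EuclideanSpace ℝ (Fin n)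

theorem fracSobolevExp_spec {s p : ℝ} (hs0 : 0 < s) (hp : 1 ≤ p) (hpn : p < n / s) :
    0 < s * p / n ∧ s * p / n < 1 ∧ p ≤ fracSobolevExp n s p ∧
      1 - s * p / n = p / fracSobolevExp n s p := by
  have hp0 : 0 < p := by linarith
  have h1 : s * p < n := by rw [lt_div_iff₀ hs0] at hpn; linarith
  have h2 : 0 < s * p := by positivity
  have hn0 : (0 : ℝ) < n := by linarith
  have h3 : 0 < (n : ℝ) - s * p := by linarith
  refine ⟨by positivity, by rwa [div_lt_one hn0], ?_, ?_⟩
  · rw [fracSobolevExp, le_div_iff₀ h3]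
    nlinarith
  · rw [fracSobolevExp]
    field_simp

/-- With `θ = sp/n`, the superlevel estimate, the absorption inequality and the Lorentz embedding
chain together through the layer cake formula. -/
theorem exists_lintegral_rpow_le_of_half (hn : 1 ≤ n) {s p : ℝ} (hs0 : 0 < s) (hp : 1 ≤ p)
    (hpn : p < n / s) :
    ∃ C : ℝ≥0∞, C ≠ ⊤ ∧ ∀ (x₀ : 𝔼) (r : ℝ) (f : 𝔼 → ℝ), Measurable f → (∀ x, 0 ≤ f x) →
      volume (Metric.ball x₀ r ∩ {x | 0 < f x}) ≤ volume (Metric.ball x₀ r) / 2 →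
      ∫⁻ x in Metric.ball x₀ r, ENNReal.ofReal (f x ^ fracSobolevExp n s p) ≤
        C * gagliardoPow s p (Metric.ball x₀ r) f ^ (fracSobolevExp n s p / p) := by
  obtain ⟨hθ0, hθ1, hpq, hθ⟩ := fracSobolevExp_spec hs0 hp hpn
  set θ := s * p / n
  set q := fracSobolevExp n s p
  have hp0 : 0 < p := by linarith
  have hq0 : 0 < q := by linarith
  have hqp : 0 ≤ q / p := by positivity
  obtain ⟨C₁, hC₁, H₁⟩ := exists_lintegral_superlevel_le (n := n) hn hs0 hp
  obtain ⟨C₂, hC₂, H₂⟩ := exists_lintegral_rpow_le_of_antitone hp hθ0 hθ1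
  refine ⟨ENNReal.ofReal q * (2 ^ p * (C₂ * C₁)) ^ (q / p), ?_, ?_⟩
  · refine ENNReal.mul_ne_top ENNReal.ofReal_ne_top (ENNReal.rpow_ne_top_of_nonneg hqp ?_)
    exact ENNReal.mul_ne_top (ENNReal.rpow_ne_top_of_nonneg hp0.le (by simp))
      (ENNReal.mul_ne_top hC₂ hC₁)
  -- Bounded functions first, since absorption needs a distribution function that vanishes
  -- eventually; truncation and monotone convergence then remove the bound.
  have hbdd : ∀ (x₀ : 𝔼) (r : ℝ) (f : 𝔼 → ℝ) (M : ℝ), Measurable f → (∀ x, 0 ≤ f x) →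
      (∀ x, f x ≤ M) →
      volume (Metric.ball x₀ r ∩ {x | 0 < f x}) ≤ volume (Metric.ball x₀ r) / 2 →
      ∫⁻ x in Metric.ball x₀ r, ENNReal.ofReal (f x ^ q) ≤
        ENNReal.ofReal q * (2 ^ p * (C₂ * C₁)) ^ (q / p) *
          gagliardoPow s p (Metric.ball x₀ r) f ^ (q / p) := by
    intro x₀ r f M hf hf0 hfM hhalf
    set N : ℝ → ℝ≥0∞ := fun t => volume (Metric.ball x₀ r ∩ {x | t < f x}) with hN
    have hNr : ∀ t, (volume.restrict (Metric.ball x₀ r)) {x | t < f x} = N t := by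
      intro t
      rw [Measure.restrict_apply (measurableSet_lt measurable_const hf), inter_comm]
    have hanti : Antitone N := fun a b hab =>
      measure_mono (inter_subset_inter_right _ fun x (hx : b < f x) =>
        show a < f x from hab.trans_lt hx)
    have hNt : ∀ t, N t ≠ ⊤ := fun t =>
      ((measure_mono inter_subset_left).trans_lt measure_ball_lt_top).ne
    have hNM : ∃ M, ∀ t, M ≤ t → N t = 0 := by
      refine ⟨M, fun t ht => ?_⟩
      have : Metric.ball x₀ r ∩ {x | t < f x} = ∅ := by
        ext x
        simp only [mem_inter_iff, mem_ofPred_eq, mem_empty_iff_false, iff_false, not_and, not_lt]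
        exact fun _ => (hfM x).trans ht
      simp only [hN, this, measure_empty]
    rw [lintegral_rpow_eq_lintegral_meas_lt_mul _ (Eventually.of_forall hf0) hf.aemeasurable hq0]
    simp_rw [hNr]
    rw [mul_assoc, ← ENNReal.mul_rpow_of_nonneg _ _ hqp]
    gcongr
    refine (lintegral_mul_rpow_le_of_antitone hp hpq hθ hanti).trans ?_
    refine ENNReal.rpow_le_rpow ?_ hqp
    rw [mul_assoc, mul_assoc]
    gcongr
    refine (H₂ N hanti hNt hNM).trans ?_
    gcongr
    exact H₁ x₀ r f hf hhalf
  intro x₀ r f hf hf0 hhalf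
  set F : ℕ → 𝔼 → ℝ≥0∞ := fun k x => ENNReal.ofReal (min (f x) k ^ q) with hF
  have hmono : ∀ x, Monotone fun k => F k x := by
    intro x i j hij
    have h0 : (0 : ℝ) ≤ min (f x) i := le_min (hf0 x) (Nat.cast_nonneg _)
    exact ENNReal.ofReal_le_ofReal (Real.rpow_le_rpow h0
      (min_le_min le_rfl (Nat.cast_le.2 hij)) hq0.le)
  have hlim : ∀ x, Tendsto (fun k => F k x) atTop (𝓝 (ENNReal.ofReal (f x ^ q))) := by
    intro x
    obtain ⟨k, hk⟩ := exists_nat_ge (f x)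
    refine tendsto_const_nhds.congr' ?_
    filter_upwards [eventually_ge_atTop k] with j hj
    simp only [hF]
    rw [min_eq_left (hk.trans (Nat.cast_le.2 hj))]
  have hFm : ∀ k, Measurable (F k) := fun k => by fun_prop
  refine le_of_tendsto' (lintegral_tendsto_of_tendsto_of_monotone (fun k => (hFm k).aemeasurable)
    (Eventually.of_forall hmono) (Eventually.of_forall hlim)) fun k => ?_
  refine (hbdd x₀ r (fun x => min (f x) k) k (by fun_prop)
    (fun x => le_min (hf0 x) (Nat.cast_nonneg _)) (fun x => min_le_right _ _) ?_).trans ?_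
  · refine le_trans (measure_mono (inter_subset_inter_right _ fun x hx => ?_)) hhalf
    exact (lt_min_iff.1 (show 0 < min (f x) (k : ℝ) from hx)).1
  · gcongr
    refine gagliardoPow_mono hp0.le Metric.isOpen_ball.measurableSet fun x _ y _ => ?_
    have := abs_min_sub_min_le_max (f x) k (f y) k
    simpa using this

/-- The fractional Sobolev–Poincaré inequality on balls. -/
theorem exists_lintegral_sub_rpow_le (hn : 1 ≤ n) {s p : ℝ} (hs0 : 0 < s) (hp : 1 ≤ p)
    (hpn : p < n / s) :
    ∃ C : ℝ≥0∞, C ≠ ⊤ ∧ ∀ (x₀ : 𝔼) (r : ℝ) (f : 𝔼 → ℝ), Measurable f →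
      ∃ m : ℝ, ∫⁻ x in Metric.ball x₀ r, ‖f x - m‖ₑ ^ fracSobolevExp n s p ≤
        C * gagliardoPow s p (Metric.ball x₀ r) f ^ (fracSobolevExp n s p / p) := by
  obtain ⟨_, _, hpq, _⟩ := fracSobolevExp_spec hs0 hp hpn
  obtain ⟨C, hC, H⟩ := exists_lintegral_rpow_le_of_half (n := n) hn hs0 hp hpn
  set q := fracSobolevExp n s p
  have hp0 : 0 < p := by linarith
  have hq0 : 0 < q := by linarith
  refine ⟨2 * C, ENNReal.mul_ne_top (by simp) hC, fun x₀ r f hf => ?_⟩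
  set B := Metric.ball x₀ r
  have hB : MeasurableSet B := Metric.isOpen_ball.measurableSet
  have : IsFiniteMeasure (volume.restrict B) := ⟨by simpa using measure_ball_lt_top⟩
  obtain ⟨m, hm1, hm2⟩ := exists_median (volume.restrict B) hf
  refine ⟨m, ?_⟩
  rw [Measure.restrict_apply_univ,
    Measure.restrict_apply (measurableSet_lt measurable_const hf), inter_comm] at hm1
  rw [Measure.restrict_apply_univ,
    Measure.restrict_apply (measurableSet_lt hf measurable_const), inter_comm] at hm2
  -- The positive and negative parts about a median are each positive on at most half of the ball,
  -- and neither has more energy than `f`.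
  have h1 := H x₀ r (fun x => max (f x - m) 0) (by fun_prop) (fun x => le_max_right _ _) (by
    refine le_trans (measure_mono (inter_subset_inter_right _ fun x hx => ?_)) hm1
    have hx' : 0 < max (f x - m) 0 := hx
    rcases lt_max_iff.1 hx' with h | h
    · exact sub_pos.1 h
    · exact absurd h (lt_irrefl _))
  have h2 := H x₀ r (fun x => max (m - f x) 0) (by fun_prop) (fun x => le_max_right _ _) (by
    refine le_trans (measure_mono (inter_subset_inter_right _ fun x hx => ?_)) hm2
    have hx' : 0 < max (m - f x) 0 := hx
    rcases lt_max_iff.1 hx' with h | h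
    · exact sub_pos.1 h
    · exact absurd h (lt_irrefl _))
  have g1 : gagliardoPow s p B (fun x => max (f x - m) 0) ≤ gagliardoPow s p B f := by
    refine gagliardoPow_mono hp0.le hB fun x _ y _ => ?_
    simpa using abs_max_sub_max_le_max (f x - m) 0 (f y - m) 0
  have g2 : gagliardoPow s p B (fun x => max (m - f x) 0) ≤ gagliardoPow s p B f := by
    refine gagliardoPow_mono hp0.le hB fun x _ y _ => ?_
    simpa [abs_sub_comm (f y)] using abs_max_sub_max_le_max (m - f x) 0 (m - f y) 0
  calc ∫⁻ x in B, ‖f x - m‖ₑ ^ q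
      ≤ ∫⁻ x in B, (ENNReal.ofReal (max (f x - m) 0 ^ q) +
          ENNReal.ofReal (max (m - f x) 0 ^ q)) := by
        refine lintegral_mono fun x => ?_
        rcases le_total m (f x) with h | h
        · refine le_add_right (le_of_eq ?_)
          rw [max_eq_left (sub_nonneg.2 h), Real.enorm_of_nonneg (sub_nonneg.2 h),
            ENNReal.ofReal_rpow_of_nonneg (sub_nonneg.2 h) hq0.le]
        · refine le_add_left (le_of_eq ?_)
          rw [max_eq_left (sub_nonneg.2 h), ← enorm_neg, neg_sub,
            Real.enorm_of_nonneg (sub_nonneg.2 h),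
            ENNReal.ofReal_rpow_of_nonneg (sub_nonneg.2 h) hq0.le]
    _ = (∫⁻ x in B, ENNReal.ofReal (max (f x - m) 0 ^ q)) +
          ∫⁻ x in B, ENNReal.ofReal (max (m - f x) 0 ^ q) :=
        lintegral_add_left (by fun_prop) _
    _ ≤ C * gagliardoPow s p B f ^ (q / p) + C * gagliardoPow s p B f ^ (q / p) := by
        refine add_le_add (h1.trans ?_) (h2.trans ?_) <;> gcongr
    _ = _ := by ring

end SobolevPoincare

/-! ### From bounded measurable competitors to test functions -/

section Mollification
variable {n : ℕ}
local notation "𝔼" => EuclideanSpace ℝ (Fin n)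

/-- The probability measure whose density is a normalized bump function. -/
noncomputable def bumpMeasure (φ : ContDiffBump (0 : 𝔼)) : Measure 𝔼 :=
  volume.withDensity fun z => ENNReal.ofReal (φ.normed volume z)

theorem measurable_normed (φ : ContDiffBump (0 : 𝔼)) : Measurable (φ.normed volume) :=
  φ.continuous_normed.measurable

theorem bumpMeasure_univ (φ : ContDiffBump (0 : 𝔼)) : bumpMeasure φ univ = 1 := by
  rw [bumpMeasure, withDensity_apply _ MeasurableSet.univ, setLIntegral_univ,
    ← ofReal_integral_eq_lintegral_ofReal φ.integrable_normed
      (Eventually.of_forall φ.nonneg_normed), φ.integral_normed, ENNReal.ofReal_one]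

theorem ae_bumpMeasure {φ : ContDiffBump (0 : 𝔼)} {P : 𝔼 → Prop}
    (h : ∀ᵐ z, z ∈ Metric.ball (0 : 𝔼) φ.rOut → P z) : ∀ᵐ z ∂bumpMeasure φ, P z := by
  rw [bumpMeasure, ae_withDensity_iff (measurable_normed φ).ennreal_ofReal]
  filter_upwards [h] with z hz hne
  apply hz
  rw [← φ.support_normed_eq (μ := volume)]
  rintro h0
  rw [h0] at hne
  simp at hne

/-- Writing the mollification as an average of translates against a probability measure makes
Jensen's inequality available. -/
theorem convolution_normed_eq_integral (φ : ContDiffBump (0 : 𝔼)) (Φ : 𝔼 → ℝ) (x : 𝔼) :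
    convolution (φ.normed volume) Φ (ContinuousLinearMap.lsmul ℝ ℝ) volume x =
      ∫ z, Φ (x - z) ∂bumpMeasure φ := by
  rw [bumpMeasure, integral_withDensity_eq_integral_toReal_smul
    (measurable_normed φ).ennreal_ofReal (by simp)]
  simp only [convolution, ContinuousLinearMap.lsmul_apply]
  refine integral_congr_ae (Eventually.of_forall fun z => ?_)
  simp only [ENNReal.toReal_ofReal (φ.nonneg_normed z)]

theorem lintegral_ball_sub_le {x₀ z : 𝔼} {r δ : ℝ} (hz : z ∈ Metric.ball (0 : 𝔼) δ)
    (F : 𝔼 → ℝ≥0∞) :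
    ∫⁻ x in Metric.ball x₀ r, F (x - z) ≤ ∫⁻ x in Metric.ball x₀ (r + δ), F x := by
  rw [← lintegral_indicator Metric.isOpen_ball.measurableSet,
    ← lintegral_indicator Metric.isOpen_ball.measurableSet,
    ← lintegral_sub_right_eq_self ((Metric.ball x₀ (r + δ)).indicator F) z]
  refine lintegral_mono fun x => ?_
  by_cases hx : x ∈ Metric.ball x₀ r
  · rw [indicator_of_mem hx, indicator_of_mem]
    rw [mem_ball_iff_norm] at hx ⊢
    rw [mem_ball_zero_iff] at hz
    calc ‖x - z - x₀‖ = ‖(x - x₀) - z‖ := by congr 1; abel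
      _ ≤ ‖x - x₀‖ + ‖z‖ := norm_sub_le _ _
      _ < r + δ := by linarith
  · rw [indicator_of_notMem hx]; exact bot_le

/-- Jensen's inequality bounds the energy of the average by the average energy of the translates; a
translate by less than `φ.rOut` sees only the slightly larger ball. -/
theorem gagliardoPow_convolution_le {s p : ℝ} (hp : 1 ≤ p) {x₀ : 𝔼} {r : ℝ}
    (φ : ContDiffBump (0 : 𝔼)) {Φ : 𝔼 → ℝ} (hΦ : Measurable Φ) {M : ℝ} (hM : ∀ x, ‖Φ x‖ ≤ M) :
    gagliardoPow s p (Metric.ball x₀ r)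
      (convolution (φ.normed volume) Φ (ContinuousLinearMap.lsmul ℝ ℝ) volume) ≤
      gagliardoPow s p (Metric.ball x₀ (r + φ.rOut)) Φ := by
  set ν := bumpMeasure φ with hν
  have hprob : IsProbabilityMeasure ν := ⟨bumpMeasure_univ φ⟩
  set Q : ℝ := n + s * p with hQ
  have hint : ∀ x : 𝔼, Integrable (fun z => Φ (x - z)) ν := fun x =>
    Integrable.of_bound (hΦ.comp (by fun_prop)).aestronglyMeasurable M
      (Eventually.of_forall fun z => hM _)
  set H : 𝔼 → 𝔼 → 𝔼 → ℝ≥0∞ := fun z x y =>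
    ‖Φ (x - z) - Φ (y - z)‖ₑ ^ p / ‖x - y‖ₑ ^ Q with hH
  have hHm : Measurable fun w : 𝔼 × 𝔼 × 𝔼 => H w.1 w.2.1 w.2.2 := by
    simp only [hH]; fun_prop
  have hjensen : ∀ x y : 𝔼,
      ‖convolution (φ.normed volume) Φ (ContinuousLinearMap.lsmul ℝ ℝ) volume x -
        convolution (φ.normed volume) Φ (ContinuousLinearMap.lsmul ℝ ℝ) volume y‖ₑ ^ p /
        ‖x - y‖ₑ ^ Q ≤ ∫⁻ z, H z x y ∂ν := by
    intro x y
    have hp0 : 0 < p := by linarith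
    rw [convolution_normed_eq_integral, convolution_normed_eq_integral,
      ← integral_sub (hint x) (hint y)]
    simp only [hH, div_eq_mul_inv]
    rw [lintegral_mul_const _ (by fun_prop)]
    gcongr
    have h1 := eLpNorm'_le_eLpNorm'_of_exponent_le (p := 1) (q := p) one_pos hp ν
      (f := fun z => Φ (x - z) - Φ (y - z)) ((hint x).sub (hint y)).aestronglyMeasurable
    simp only [eLpNorm'_eq_lintegral_enorm, ENNReal.rpow_one, div_one] at h1
    calc _ ≤ (∫⁻ z, ‖Φ (x - z) - Φ (y - z)‖ₑ ∂ν) ^ p :=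
          ENNReal.rpow_le_rpow (enorm_integral_le_lintegral_enorm _) hp0.le
      _ ≤ ((∫⁻ z, ‖Φ (x - z) - Φ (y - z)‖ₑ ^ p ∂ν) ^ (1 / p)) ^ p :=
          ENNReal.rpow_le_rpow h1 hp0.le
      _ = _ := by rw [← ENNReal.rpow_mul, one_div, inv_mul_cancel₀ hp0.ne', ENNReal.rpow_one]
  have hm1 : Measurable fun w : 𝔼 × 𝔼 => ∫⁻ y in Metric.ball x₀ r, H w.2 w.1 y := by
    have : Measurable fun w : (𝔼 × 𝔼) × 𝔼 => H w.1.2 w.1.1 w.2 :=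
      hHm.comp (g := fun w : 𝔼 × 𝔼 × 𝔼 => H w.1 w.2.1 w.2.2)
        (f := fun w : (𝔼 × 𝔼) × 𝔼 => (w.1.2, w.1.1, w.2)) (by fun_prop)
    exact this.lintegral_prod_right'
  calc _ ≤ ∫⁻ x in Metric.ball x₀ r, ∫⁻ y in Metric.ball x₀ r, ∫⁻ z, H z x y ∂ν :=
        lintegral_mono fun x => lintegral_mono fun y => hjensen x y
    _ = ∫⁻ x in Metric.ball x₀ r, ∫⁻ z, (∫⁻ y in Metric.ball x₀ r, H z x y) ∂ν := by
        refine lintegral_congr fun x => ?_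
        have : Measurable fun w : 𝔼 × 𝔼 => H w.2 x w.1 :=
          hHm.comp (g := fun w : 𝔼 × 𝔼 × 𝔼 => H w.1 w.2.1 w.2.2)
            (f := fun w : 𝔼 × 𝔼 => (w.2, x, w.1)) (by fun_prop)
        rw [lintegral_lintegral_swap this.aemeasurable]
    _ = ∫⁻ z, (∫⁻ x in Metric.ball x₀ r, ∫⁻ y in Metric.ball x₀ r, H z x y) ∂ν := by
        rw [lintegral_lintegral_swap hm1.aemeasurable]
    _ ≤ ∫⁻ _, gagliardoPow s p (Metric.ball x₀ (r + φ.rOut)) Φ ∂ν := by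
        refine lintegral_mono_ae (ae_bumpMeasure (Eventually.of_forall fun z hz => ?_))
        calc _ = ∫⁻ x in Metric.ball x₀ r, (fun x' => ∫⁻ y in Metric.ball x₀ r,
              (fun y' => ‖Φ x' - Φ y'‖ₑ ^ p / ‖x' - y'‖ₑ ^ Q) (y - z)) (x - z) := by
              simp only [hH, sub_sub_sub_cancel_right]
          _ ≤ ∫⁻ x in Metric.ball x₀ (r + φ.rOut), ∫⁻ y in Metric.ball x₀ r,
              (fun y' => ‖Φ x - Φ y'‖ₑ ^ p / ‖x - y'‖ₑ ^ Q) (y - z) :=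
              lintegral_ball_sub_le hz _
          _ ≤ _ := lintegral_mono fun x => lintegral_ball_sub_le hz _
    _ = _ := by rw [lintegral_const, measure_univ, mul_one]

/-- Points of the added shell stay at distance at least `r - ρ` from where `Φ` is nonzero, so the
kernel is bounded there and the extra energy is proportional to the volume of the shell. -/
theorem gagliardoPow_ball_add_le {s p : ℝ} (hp : 0 < p) (hs : 0 ≤ s) {x₀ : 𝔼} {r ρ δ : ℝ}
    (hρ : ρ < r) (hδ : 0 < δ) {Φ : 𝔼 → ℝ} {M : ℝ} (hM : ∀ x, ‖Φ x‖ ≤ M)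
    (hsupp : ∀ x, x ∉ Metric.closedBall x₀ ρ → Φ x = 0) :
    gagliardoPow s p (Metric.ball x₀ (r + δ)) Φ ≤ gagliardoPow s p (Metric.ball x₀ r) Φ +
      2 * (ENNReal.ofReal M ^ p / ENNReal.ofReal (r - ρ) ^ ((n : ℝ) + s * p)) *
        volume (Metric.ball x₀ (r + δ)) *
          (volume (Metric.ball x₀ (r + δ)) - volume (Metric.ball x₀ r)) := by
  set Q : ℝ := n + s * p with hQ
  have hQ0 : 0 ≤ Q := by positivity
  set κ := ENNReal.ofReal M ^ p / ENNReal.ofReal (r - ρ) ^ Q with hκ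
  set B := Metric.ball x₀ r with hBd
  set B' := Metric.ball x₀ (r + δ) with hBd'
  have hB : MeasurableSet B := Metric.isOpen_ball.measurableSet
  have hB' : MeasurableSet B' := Metric.isOpen_ball.measurableSet
  have hBB : B ⊆ B' := Metric.ball_subset_ball (by linarith)
  have hA : volume (B' \ B) = volume B' - volume B :=
    measure_sdiff hBB hB.nullMeasurableSet measure_ball_lt_top.ne
  have hsplit : ∀ F : 𝔼 → ℝ≥0∞, ∫⁻ x in B', F x = (∫⁻ x in B, F x) + ∫⁻ x in B' \ B, F x := by
    intro F
    rw [← lintegral_inter_add_sdiff F B' hB, inter_eq_right.2 hBB]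
  have hfar : ∀ x ∉ B, ∀ y, ‖Φ y‖ₑ ^ p / ‖x - y‖ₑ ^ Q ≤ κ := by
    intro x hx y
    by_cases hy : y ∈ Metric.closedBall x₀ ρ
    · have hM' : ‖Φ y‖ₑ ≤ ENNReal.ofReal M := by
        rw [← ofReal_norm]; exact ENNReal.ofReal_le_ofReal (hM y)
      have hd : ENNReal.ofReal (r - ρ) ≤ ‖x - y‖ₑ := by
        rw [← ofReal_norm, ← dist_eq_norm]
        refine ENNReal.ofReal_le_ofReal ?_
        have h1 : r ≤ dist x x₀ := by simpa [hBd] using hx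
        have h2 : dist y x₀ ≤ ρ := hy
        linarith [dist_triangle x y x₀]
      rw [hκ]
      gcongr
    · rw [hsupp y hy]
      simp [hp]
  have hout : ∀ x ∉ B, Φ x = 0 := fun x hx =>
    hsupp x fun h => hx (Metric.closedBall_subset_ball hρ h)
  have h1 : ∀ x ∉ B, ∀ y, ‖Φ x - Φ y‖ₑ ^ p / ‖x - y‖ₑ ^ Q ≤ κ := by
    intro x hx y
    rw [hout x hx, zero_sub, enorm_neg]
    exact hfar x hx y
  have h2 : ∀ x ∉ B, ∀ y, ‖Φ y - Φ x‖ₑ ^ p / ‖y - x‖ₑ ^ Q ≤ κ := by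
    intro x hx y
    rw [← enorm_neg, neg_sub, ← enorm_neg (y - x), neg_sub]
    exact h1 x hx y
  have hc : ∀ S : Set 𝔼, MeasurableSet S → ∀ F : 𝔼 → ℝ≥0∞, ∀ a, (∀ x ∈ S, F x ≤ a) →
      ∫⁻ x in S, F x ≤ a * volume S := fun S hS F a h => by
    rw [← setLIntegral_const]
    exact setLIntegral_mono' hS h
  calc gagliardoPow s p B' Φ
      = (∫⁻ x in B, ((∫⁻ y in B, ‖Φ x - Φ y‖ₑ ^ p / ‖x - y‖ₑ ^ Q) +
          ∫⁻ y in B' \ B, ‖Φ x - Φ y‖ₑ ^ p / ‖x - y‖ₑ ^ Q)) +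
        ∫⁻ x in B' \ B, ∫⁻ y in B', ‖Φ x - Φ y‖ₑ ^ p / ‖x - y‖ₑ ^ Q := by
        unfold gagliardoPow
        rw [hsplit]
        congr 1
        exact lintegral_congr fun x => hsplit _
    _ ≤ (∫⁻ x in B, ((∫⁻ y in B, ‖Φ x - Φ y‖ₑ ^ p / ‖x - y‖ₑ ^ Q) + κ * volume (B' \ B))) +
        κ * volume B' * volume (B' \ B) := by
        refine add_le_add (lintegral_mono fun x => add_le_add le_rfl ?_) ?_
        · exact hc _ (hB'.diff hB) _ _ fun y hy => h2 y hy.2 x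
        · exact hc _ (hB'.diff hB) _ _ fun x hx => hc _ hB' _ _ fun y _ => h1 x hx.2 y
    _ = gagliardoPow s p B Φ + κ * volume (B' \ B) * volume B +
        κ * volume B' * volume (B' \ B) := by
        rw [lintegral_add_right _ measurable_const, setLIntegral_const]
        rfl
    _ ≤ gagliardoPow s p B Φ + κ * volume (B' \ B) * volume B' +
        κ * volume B' * volume (B' \ B) := by gcongr
    _ = _ := by rw [hA]; ring

/-- Mollifications of `Φ` at scale `δ` are admissible test functions: they are at least one on `K`
once the `δ`-neighbourhood of `K` lies in `U`, and supported in the ball once `δ < r - ρ`. The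
excess energy vanishes as `δ → 0`. -/
theorem compactCap_ball_le_gagliardoPow {s p : ℝ} (hp : 1 ≤ p) (hs : 0 ≤ s) {x₀ : 𝔼} {r ρ : ℝ}
    (hr : 0 < r) (hρ : ρ < r) {K U : Set 𝔼} (hK : IsCompact K) (hU : IsOpen U) (hKU : K ⊆ U)
    {Φ : 𝔼 → ℝ} (hΦ : Measurable Φ) {M : ℝ} (hM : ∀ x, ‖Φ x‖ ≤ M)
    (hsupp : ∀ x, x ∉ Metric.closedBall x₀ ρ → Φ x = 0) (hge : ∀ᵐ x, x ∈ U → 1 ≤ Φ x) :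
    compactCap s p K (Metric.ball x₀ r) ≤ gagliardoPow s p (Metric.ball x₀ r) Φ := by
  obtain ⟨δ₀, hδ₀, hthick⟩ := hK.exists_thickening_subset_open hU hKU
  set κ := 2 * (ENNReal.ofReal M ^ p / ENNReal.ofReal (r - ρ) ^ ((n : ℝ) + s * p)) with hκ
  have hκt : κ ≠ ⊤ := by
    refine ENNReal.mul_ne_top (by simp) (ENNReal.div_ne_top
      (ENNReal.rpow_ne_top_of_nonneg (by linarith) ENNReal.ofReal_ne_top) ?_)
    exact (ENNReal.rpow_pos (by simpa using hρ) ENNReal.ofReal_ne_top).ne'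
  have hΦi : LocallyIntegrable Φ volume := by
    refine (locallyIntegrable_const M).mono hΦ.aestronglyMeasurable
      (Eventually.of_forall fun x => (hM x).trans (le_abs_self M))
  have hbound : ∀ δ : ℝ, 0 < δ → δ < δ₀ → δ < r - ρ →
      compactCap s p K (Metric.ball x₀ r) ≤ gagliardoPow s p (Metric.ball x₀ r) Φ +
        κ * volume (Metric.ball x₀ (r + δ)) *
          (volume (Metric.ball x₀ (r + δ)) - volume (Metric.ball x₀ r)) := by
    intro δ hδ hδ1 hδ2
    let φ : ContDiffBump (0 : 𝔼) := ⟨δ / 2, δ, by positivity, by linarith⟩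
    have hφ : φ.rOut = δ := rfl
    have hprob : IsProbabilityMeasure (bumpMeasure φ) := ⟨bumpMeasure_univ φ⟩
    set v := convolution (φ.normed volume) Φ (ContinuousLinearMap.lsmul ℝ ℝ) volume with hv
    have hvsupp : ∀ x, x ∉ Metric.closedBall x₀ (ρ + δ) → v x = 0 := by
      intro x hx
      rw [hv, convolution_normed_eq_integral]
      refine integral_eq_zero_of_ae (ae_bumpMeasure (Eventually.of_forall fun z hz => ?_))
      refine hsupp _ fun h => hx ?_
      rw [mem_closedBall_iff_norm] at h ⊢
      rw [mem_ball_zero_iff, hφ] at hz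
      calc ‖x - x₀‖ = ‖(x - z - x₀) + z‖ := by congr 1; abel
        _ ≤ ‖x - z - x₀‖ + ‖z‖ := norm_add_le _ _
        _ ≤ ρ + δ := by linarith
    have htsupp : tsupport v ⊆ Metric.closedBall x₀ (ρ + δ) := by
      refine closure_minimal (fun x hx => ?_) Metric.isClosed_closedBall
      by_contra h
      exact hx (hvsupp x h)
    have htest : IsTestFunction (Metric.ball x₀ r) v := by
      refine ⟨?_, ?_, ?_⟩
      · exact φ.hasCompactSupport_normed.contDiff_convolution_left _ φ.contDiff_normed hΦi
      · exact HasCompactSupport.of_support_subset_isCompact (isCompact_closedBall x₀ (ρ + δ))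
          ((subset_tsupport v).trans htsupp)
      · exact htsupp.trans (Metric.closedBall_subset_ball (by linarith))
    have hone : ∀ x ∈ K, 1 ≤ v x := by
      intro x hx
      rw [hv, convolution_normed_eq_integral]
      have h1 : ∀ᵐ z : 𝔼, x - z ∈ U → 1 ≤ Φ (x - z) :=
        (quasiMeasurePreserving_sub_left volume x).ae hge
      have h2 : ∀ᵐ z ∂bumpMeasure φ, (1 : ℝ) ≤ Φ (x - z) := by
        refine ae_bumpMeasure ?_
        filter_upwards [h1] with z hz hzb
        refine hz (hthick ?_)
        rw [Metric.mem_thickening_iff]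
        refine ⟨x, hx, ?_⟩
        rw [mem_ball_zero_iff, hφ] at hzb
        simpa [dist_eq_norm] using hzb.trans hδ1
      have h3 := integral_mono_ae (integrable_const (1 : ℝ))
        (Integrable.of_bound (hΦ.comp (by fun_prop)).aestronglyMeasurable M
          (Eventually.of_forall fun z => hM _)) h2
      simpa using h3
    calc compactCap s p K (Metric.ball x₀ r) ≤ gagliardoPow s p (Metric.ball x₀ r) v :=
          iInf_le_of_le v (iInf_le_of_le htest (iInf_le_of_le hone le_rfl))
      _ ≤ gagliardoPow s p (Metric.ball x₀ (r + δ)) Φ := gagliardoPow_convolution_le hp φ hΦ hM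
      _ ≤ _ := gagliardoPow_ball_add_le (by linarith) hs hρ hδ hM hsupp
  have hvol : Tendsto (fun δ : ℝ => volume (Metric.ball x₀ (r + δ))) (𝓝[>] 0)
      (𝓝 (volume (Metric.ball x₀ r))) := by
    have e : ∀ t : ℝ, 0 < t → volume (Metric.ball x₀ t) =
        ENNReal.ofReal (t ^ n) * volume (Metric.ball (0 : 𝔼) 1) := by
      intro t ht
      rw [Measure.addHaar_ball_of_pos _ _ ht, finrank_euclideanSpace, Fintype.card_fin]
    have hc : Tendsto (fun δ : ℝ => ENNReal.ofReal ((r + δ) ^ n)) (𝓝[>] 0)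
        (𝓝 (ENNReal.ofReal (r ^ n))) := by
      have : Continuous fun δ : ℝ => ENNReal.ofReal ((r + δ) ^ n) :=
        ENNReal.continuous_ofReal.comp (by fun_prop)
      simpa using (this.tendsto 0).mono_left nhdsWithin_le_nhds
    rw [e r hr]
    refine (ENNReal.Tendsto.mul_const hc (Or.inr measure_ball_lt_top.ne)).congr' ?_
    filter_upwards [self_mem_nhdsWithin] with δ hδ
    exact (e (r + δ) (add_pos hr hδ)).symm
  have hlim : Tendsto (fun δ : ℝ => gagliardoPow s p (Metric.ball x₀ r) Φ +
        κ * volume (Metric.ball x₀ (r + δ)) *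
          (volume (Metric.ball x₀ (r + δ)) - volume (Metric.ball x₀ r))) (𝓝[>] 0)
      (𝓝 (gagliardoPow s p (Metric.ball x₀ r) Φ)) := by
    have hV : volume (Metric.ball x₀ r) ≠ ⊤ := measure_ball_lt_top.ne
    have h1 := ENNReal.Tendsto.sub hvol (tendsto_const_nhds (x := volume (Metric.ball x₀ r)))
      (Or.inl hV)
    have h2 := ENNReal.Tendsto.const_mul (a := κ) hvol (Or.inr hκt)
    have h3 := ENNReal.Tendsto.mul h2 (Or.inr (by simp)) h1
      (Or.inr (ENNReal.mul_ne_top hκt hV))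
    simpa using h3.const_add (gagliardoPow s p (Metric.ball x₀ r) Φ)
  refine ge_of_tendsto hlim ?_
  have hev : ∀ a : ℝ, 0 < a → ∀ᶠ δ : ℝ in 𝓝[>] 0, δ < a := fun a ha =>
    (eventually_lt_nhds ha).filter_mono nhdsWithin_le_nhds
  filter_upwards [self_mem_nhdsWithin, hev δ₀ hδ₀, hev (r - ρ) (sub_pos.2 hρ)] with δ h1 h2 h3
  exact hbound δ h1 h2 h3

end Mollification

/-! ### Almost everywhere convergence from convexity -/

section Convex

/-- A sequence of sets of `[0, 1]`-valued functions that is decreasing and stable under midpoints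
admits a choice of elements that converges almost everywhere. -/
theorem exists_mem_tendsto_ae_of_midpoint {α : Type*} [MeasurableSpace α] (μ : Measure α)
    [IsFiniteMeasure μ] {S : ℕ → Set (α → ℝ)} (hanti : Antitone S) (hne : ∀ m, (S m).Nonempty)
    (hmeas : ∀ m, ∀ g ∈ S m, Measurable g) (hIcc : ∀ m, ∀ g ∈ S m, ∀ x, g x ∈ Icc (0 : ℝ) 1)
    (hmid : ∀ m, ∀ g ∈ S m, ∀ h ∈ S m, (fun x => (g x + h x) / 2) ∈ S m) :
    ∃ (g : ℕ → α → ℝ) (ψ : α → ℝ), (∀ k, g k ∈ S k) ∧ Measurable ψ ∧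
      (∀ x, ψ x ∈ Icc (0 : ℝ) 1) ∧ ∀ᵐ x ∂μ, Tendsto (fun k => g k x) atTop (𝓝 (ψ x)) := by
  set T : ℕ → Set (Lp ℝ 2 μ) := fun m => {F | ∃ g ∈ S m, F =ᵐ[μ] g} with hT
  have hTanti : Antitone T := fun i j hij F ⟨g, hg, hF⟩ => ⟨g, hanti hij hg, hF⟩
  have hTne : ∀ m, (T m).Nonempty := by
    intro m
    obtain ⟨g, hg⟩ := hne m
    have hL : MemLp g 2 μ := MemLp.of_bound (hmeas m g hg).aestronglyMeasurable 1
      (Eventually.of_forall fun x => by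
        rw [Real.norm_of_nonneg (hIcc m g hg x).1]; exact (hIcc m g hg x).2)
    exact ⟨hL.toLp g, g, hg, hL.coeFn_toLp⟩
  set R : ℝ := (measureUnivNNReal μ : ℝ) ^ (ENNReal.toReal 2)⁻¹ * 1 with hR
  have hTR : ∀ m, ∀ F ∈ T m, ‖F‖ ≤ R := by
    rintro m F ⟨g, hg, hF⟩
    refine Lp.norm_le_of_ae_bound zero_le_one ?_
    filter_upwards [hF] with x hx
    rw [hx, Real.norm_of_nonneg (hIcc m g hg x).1]
    exact (hIcc m g hg x).2
  have hTmid : ∀ m, ∀ F ∈ T m, ∀ G ∈ T m, (1 / 2 : ℝ) • (F + G) ∈ T m := by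
    rintro m F ⟨g, hg, hF⟩ G ⟨h, hh, hG⟩
    refine ⟨_, hmid m g hg h hh, ?_⟩
    filter_upwards [hF, hG, Lp.coeFn_smul (1 / 2 : ℝ) (F + G), Lp.coeFn_add F G] with x h1 h2 h3 h4
    rw [h3, Pi.smul_apply, h4, Pi.add_apply, h1, h2, smul_eq_mul]
    ring
  -- The minimal `L²` norms increase with `m` and are bounded, hence converge. By the parallelogram
  -- law and stability under midpoints, near-minimizers then form a Cauchy sequence.
  set a : ℕ → ℝ := fun m => sInf (norm '' T m) with ha
  have hbdd : ∀ m, BddBelow (norm '' T m) := fun m =>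
    ⟨0, by rintro _ ⟨F, _, rfl⟩; exact norm_nonneg _⟩
  have hale : ∀ m, ∀ F ∈ T m, a m ≤ ‖F‖ := fun m F hF =>
    csInf_le (hbdd m) (mem_image_of_mem _ hF)
  have ha0 : ∀ m, 0 ≤ a m := fun m => Real.sInf_nonneg (by rintro _ ⟨F, _, rfl⟩; exact norm_nonneg _)
  have hamono : Monotone a := fun i j hij =>
    csInf_le_csInf (hbdd i) ((hTne j).image _) (image_mono (hTanti hij))
  have habdd : BddAbove (range a) := by
    refine ⟨R, ?_⟩
    rintro _ ⟨m, rfl⟩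
    obtain ⟨F, hF⟩ := hTne m
    exact (hale m F hF).trans (hTR m F hF)
  set A := ⨆ m, a m with hA
  have haA : ∀ m, a m ≤ A := fun m => le_ciSup habdd m
  have hlim : Tendsto a atTop (𝓝 A) := tendsto_atTop_ciSup hamono habdd
  set e : ℕ → ℝ := fun m => 1 / ((m : ℝ) + 1) with he
  have he0 : ∀ m, 0 < e m := fun m => Nat.one_div_pos_of_nat
  have hea : Antitone e := fun i j hij => Nat.one_div_le_one_div hij
  have hch : ∀ m, ∃ F ∈ T m, ‖F‖ < a m + e m := by
    intro m
    obtain ⟨_, ⟨F, hF, rfl⟩, hlt⟩ := exists_lt_of_csInf_lt ((hTne m).image norm)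
      (show sInf (norm '' T m) < a m + e m by have := he0 m; simp only [ha]; linarith)
    exact ⟨F, hF, hlt⟩
  choose F hFT hFlt using hch
  have hcauchy : CauchySeq F := by
    refine cauchySeq_of_le_tendsto_0 (fun N => √(4 * ((A + e N) ^ 2 - a N ^ 2))) ?_ ?_
    · intro i j N hi hj
      rw [dist_eq_norm]
      refine Real.le_sqrt_of_sq_le ?_
      have h1 : ‖F i‖ ≤ A + e N := (hFlt i).le.trans (add_le_add (haA i) (hea hi))
      have h2 : ‖F j‖ ≤ A + e N := (hFlt j).le.trans (add_le_add (haA j) (hea hj))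
      have h3 : 2 * a N ≤ ‖F i + F j‖ := by
        have := hale N _ (hTmid N _ (hTanti hi (hFT i)) _ (hTanti hj (hFT j)))
        rw [norm_smul, Real.norm_of_nonneg (by norm_num)] at this
        linarith
      have h4 := parallelogram_law_with_norm ℝ (F i) (F j)
      have h5 : ‖F i‖ * ‖F i‖ ≤ (A + e N) ^ 2 := by nlinarith [norm_nonneg (F i)]
      have h6 : ‖F j‖ * ‖F j‖ ≤ (A + e N) ^ 2 := by nlinarith [norm_nonneg (F j)]
      have h7 : (2 * a N) ^ 2 ≤ ‖F i + F j‖ * ‖F i + F j‖ := by nlinarith [ha0 N]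
      nlinarith
    · have h1 : Tendsto (fun N => √(4 * ((A + e N) ^ 2 - a N ^ 2))) atTop
          (𝓝 √(4 * ((A + 0) ^ 2 - A ^ 2))) :=
        ((((tendsto_one_div_add_atTop_nhds_zero_nat.const_add A).pow 2).sub
          (hlim.pow 2)).const_mul 4).sqrt
      simpa using h1
  obtain ⟨L, hL⟩ := cauchySeq_tendsto_of_complete hcauchy
  obtain ⟨ns, hns, hae⟩ := (tendstoInMeasure_of_tendsto_Lp hL).exists_seq_tendsto_ae
  choose g hgS hFg using hFT
  have hLm : Measurable (L : α → ℝ) := (Lp.stronglyMeasurable L).measurable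
  -- A subsequence index satisfies `k ≤ ns k`, so the chosen element still lies in `S k`. Clamping
  -- the limit makes it `[0, 1]`-valued everywhere and changes nothing where convergence holds.
  refine ⟨fun k => g (ns k), fun x => max 0 (min (L x) 1), fun k => hanti (hns.id_le k) (hgS _),
    by fun_prop, fun x => ⟨le_max_left _ _, max_le zero_le_one (min_le_right _ _)⟩, ?_⟩
  filter_upwards [hae, ae_all_iff.2 fun k => hFg (ns k)] with x hx hg
  have h1 : Tendsto (fun k => max 0 (min (F (ns k) x) 1)) atTop (𝓝 (max 0 (min (L x) 1))) :=
    tendsto_const_nhds.max (hx.min tendsto_const_nhds)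
  refine h1.congr fun k => ?_
  have h2 := hIcc _ _ (hgS (ns k)) x
  rw [hg k, min_eq_left h2.2, max_eq_right h2.1]

end Convex

/-! ### Capacity bounds from quasi continuous competitors -/

section Capacity
variable {n : ℕ}
local notation "𝔼" => EuclideanSpace ℝ (Fin n)

/-- The radial Lipschitz cutoff that is `1` on the ball of radius `a` and `0` outside the ball of
radius `b`. -/
noncomputable def radialCutoff (x₀ : 𝔼) (a b : ℝ) (x : 𝔼) : ℝ :=
  max 0 (min ((b - ‖x - x₀‖) / (b - a)) 1)

theorem measurable_radialCutoff (x₀ : 𝔼) (a b : ℝ) : Measurable (radialCutoff x₀ a b) := by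
  unfold radialCutoff; fun_prop

theorem continuous_radialCutoff (x₀ : 𝔼) (a b : ℝ) : Continuous (radialCutoff x₀ a b) := by
  unfold radialCutoff; fun_prop

theorem radialCutoff_mem_Icc (x₀ : 𝔼) (a b : ℝ) (x : 𝔼) : radialCutoff x₀ a b x ∈ Icc (0 : ℝ) 1 :=
  ⟨le_max_left _ _, max_le zero_le_one (min_le_right _ _)⟩

theorem radialCutoff_eq_one {x₀ : 𝔼} {a b : ℝ} (hab : a < b) {x : 𝔼}
    (hx : x ∈ Metric.closedBall x₀ a) : radialCutoff x₀ a b x = 1 := by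
  rw [mem_closedBall_iff_norm] at hx
  have : 1 ≤ (b - ‖x - x₀‖) / (b - a) := by
    rw [one_le_div (sub_pos.2 hab)]; linarith
  rw [radialCutoff, min_eq_right this, max_eq_right zero_le_one]

theorem radialCutoff_eq_zero {x₀ : 𝔼} {a b : ℝ} (hab : a < b) {x : 𝔼}
    (hx : x ∉ Metric.closedBall x₀ b) : radialCutoff x₀ a b x = 0 := by
  rw [mem_closedBall_iff_norm, not_le] at hx
  have : (b - ‖x - x₀‖) / (b - a) ≤ 0 := div_nonpos_of_nonpos_of_nonneg (by linarith) (by linarith)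
  rw [radialCutoff, max_eq_left]
  exact (min_le_left _ _).trans this

theorem abs_radialCutoff_sub_le {x₀ : 𝔼} {a b : ℝ} (hab : a < b) (x y : 𝔼) :
    |radialCutoff x₀ a b x - radialCutoff x₀ a b y| ≤ (1 / (b - a)) * ‖x - y‖ := by
  have hba : 0 < b - a := sub_pos.2 hab
  have h1 : |radialCutoff x₀ a b x - radialCutoff x₀ a b y| ≤
      |(b - ‖x - x₀‖) / (b - a) - (b - ‖y - x₀‖) / (b - a)| := by
    unfold radialCutoff
    refine (abs_max_sub_max_le_max _ _ _ _).trans ?_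
    rw [sub_self, abs_zero, max_eq_right (abs_nonneg _)]
    refine (abs_min_sub_min_le_max _ _ _ _).trans ?_
    simp
  refine h1.trans ?_
  rw [← sub_div, abs_div, abs_of_pos hba, div_eq_mul_one_div, mul_comm]
  gcongr
  rw [sub_sub_sub_cancel_left, abs_sub_comm]
  refine (abs_norm_sub_norm_le _ _).trans (le_of_eq ?_)
  congr 1
  abel

/-- An open set of small capacity carries a function of small energy that is `1` on it and is the
pointwise limit of compactly supported functions of small energy. -/
theorem exists_potential_of_fracCap_lt {s p : ℝ} (hp : 1 ≤ p) {x₀ : 𝔼} {r : ℝ} {G : Set 𝔼}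
    (hG : IsOpen G) (hGB : G ⊆ Metric.ball x₀ r) {ε : ℝ≥0∞}
    (hε : fracCap s p G (Metric.ball x₀ r) < ε) :
    ∃ (g : ℕ → 𝔼 → ℝ) (ψ : 𝔼 → ℝ),
      (∀ k, Measurable (g k) ∧ (∀ x, g k x ∈ Icc (0 : ℝ) 1) ∧
        (∃ ρ < r, ∀ x ∉ Metric.closedBall x₀ ρ, g k x = 0) ∧
        gagliardoPow s p (Metric.ball x₀ r) (g k) ≤ ε) ∧
      Measurable ψ ∧ (∀ x, ψ x ∈ Icc (0 : ℝ) 1) ∧ gagliardoPow s p (Metric.ball x₀ r) ψ ≤ ε ∧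
      (∀ᵐ x ∂volume.restrict (Metric.ball x₀ r), Tendsto (fun k => g k x) atTop (𝓝 (ψ x))) ∧
      ∀ᵐ x ∂volume.restrict (Metric.ball x₀ r), x ∈ G → 1 ≤ ψ x := by
  set B := Metric.ball x₀ r with hBd
  have hB : MeasurableSet B := Metric.isOpen_ball.measurableSet
  have : IsFiniteMeasure (volume.restrict B) := ⟨by simpa using measure_ball_lt_top⟩
  have hp0 : 0 ≤ p := by linarith
  rw [fracCap_eq_openCap s p hG hGB] at hε
  obtain ⟨K, hKc, hKG, hKU, hKm⟩ := hG.exists_iUnion_isClosed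
  have hKcomp : ∀ m, IsCompact (K m) := fun m =>
    Metric.isCompact_of_isClosed_isBounded (hKc m)
      (Metric.isBounded_ball.subset ((hKG m).trans hGB))
  -- Competitors for the `m`-th compact set of an exhaustion of `G`. The capacity of `G` is a
  -- supremum over compact subsets, so no single competitor serves all of `G`; the limit `ψ` does,
  -- but its compact support may be lost.
  set S : ℕ → Set (𝔼 → ℝ) := fun m => {g | Measurable g ∧ (∀ x, g x ∈ Icc (0 : ℝ) 1) ∧
    (∃ ρ < r, ∀ x ∉ Metric.closedBall x₀ ρ, g x = 0) ∧ gagliardoPow s p B g ≤ ε ∧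
    ∀ x ∈ K m, g x = 1} with hS
  have hSanti : Antitone S := fun i j hij g hg =>
    ⟨hg.1, hg.2.1, hg.2.2.1, hg.2.2.2.1, fun x hx => hg.2.2.2.2 x (hKm hij hx)⟩
  have hSne : ∀ m, (S m).Nonempty := by
    intro m
    have h0 : compactCap s p (K m) B ≤ openCap s p G B :=
      le_iSup_of_le (K m) (le_iSup_of_le (hKcomp m) (le_iSup_of_le (hKG m) le_rfl))
    have h1 := h0.trans_lt hε
    simp only [compactCap, iInf_lt_iff] at h1
    obtain ⟨v, hv, hv1, hvε⟩ := h1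
    obtain ⟨ρ, hρ, hvρ⟩ := exists_lt_subset_ball (isClosed_tsupport v) hv.2.2
    refine ⟨fun x => max 0 (min (v x) 1), ?_, fun x =>
      ⟨le_max_left _ _, max_le zero_le_one (min_le_right _ _)⟩, ⟨ρ, hρ, fun x hx => ?_⟩, ?_, ?_⟩
    · have := hv.1.continuous.measurable
      fun_prop
    · have : v x = 0 := by
        by_contra h
        exact hx (Metric.ball_subset_closedBall (hvρ (subset_tsupport v h)))
      simp [this]
    · refine le_trans (gagliardoPow_mono hp0 hB fun x _ y _ => ?_) hvε.le
      refine (abs_max_sub_max_le_max _ _ _ _).trans ?_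
      rw [sub_self, abs_zero, max_eq_right (abs_nonneg _)]
      refine (abs_min_sub_min_le_max _ _ _ _).trans ?_
      simp
    · intro x hx
      simp [hv1 x hx]
  have hSmid : ∀ m, ∀ g ∈ S m, ∀ h ∈ S m, (fun x => (g x + h x) / 2) ∈ S m := by
    rintro m g ⟨hg1, hg2, ⟨ρ, hρ, hg3⟩, hg4, hg5⟩ h ⟨hh1, hh2, ⟨σ, hσ, hh3⟩, hh4, hh5⟩
    refine ⟨by fun_prop, fun x => ⟨?_, ?_⟩, ⟨max ρ σ, max_lt hρ hσ, fun x hx => ?_⟩,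
      gagliardoPow_midpoint_le hp hB hg1 hh1 hg4 hh4, fun x hx => ?_⟩
    · have h1 := (hg2 x).1
      have h2 := (hh2 x).1
      positivity
    · have h1 := (hg2 x).2
      have h2 := (hh2 x).2
      linarith
    · dsimp only
      rw [hg3 x fun h => hx (Metric.closedBall_subset_closedBall (le_max_left _ _) h),
        hh3 x fun h => hx (Metric.closedBall_subset_closedBall (le_max_right _ _) h)]
      norm_num
    · dsimp only
      rw [hg5 x hx, hh5 x hx]; norm_num
  obtain ⟨g, ψ, hgS, hψm, hψI, hlim⟩ := exists_mem_tendsto_ae_of_midpoint (volume.restrict B)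
    hSanti hSne (fun m g hg => hg.1) (fun m g hg => hg.2.1) hSmid
  refine ⟨g, ψ, fun k => ⟨(hgS k).1, (hgS k).2.1, (hgS k).2.2.1, (hgS k).2.2.2.1⟩, hψm, hψI,
    gagliardoPow_le_of_tendsto_ae (fun k => (hgS k).1) (fun k => (hgS k).2.2.2.1) hlim, hlim, ?_⟩
  filter_upwards [hlim] with x hx hxG
  rw [← hKU] at hxG
  obtain ⟨m, hm⟩ := mem_iUnion.1 hxG
  refine le_of_eq (tendsto_nhds_unique (tendsto_const_nhds.congr' ?_) hx)
  filter_upwards [eventually_ge_atTop m] with k hk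
  exact ((hSanti hk (hgS k)).2.2.2.2 x hm).symm

/-- Enlarge `E` to the open set where `w > 1/2`, up to a set `G` of small capacity, and test compact
subsets with the maximum of `2w` and a potential for `G`. The factor `2^p` comes from doubling `w`;
the contribution of `G` tends to zero with `ε`. -/
theorem fracCap_le_of_quasiContinuous (hn : 1 ≤ n) {s p : ℝ} (hs0 : 0 ≤ s) (hs1 : s < 1)
    (hp : 1 ≤ p) {x₀ : 𝔼} {r ρ₀ : ℝ} (hr : 0 < r) (hρ₀ : ρ₀ < r) {E : Set 𝔼}
    (hE : E ⊆ Metric.ball x₀ r) {w : 𝔼 → ℝ}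
    (hwm : AEMeasurable w (volume.restrict (Metric.ball x₀ r)))
    (hwI : ∀ x, w x ∈ Icc (0 : ℝ) 1) (hw0 : ∀ x ∉ Metric.closedBall x₀ ρ₀, w x = 0)
    (hwE : ∀ x ∈ E, w x = 1) (hwq : IsFracQuasiContinuous s p (Metric.ball x₀ r) w) :
    fracCap s p E (Metric.ball x₀ r) ≤ 2 ^ p * gagliardoPow s p (Metric.ball x₀ r) w := by
  have hp0 : 0 < p := by linarith
  set B := Metric.ball x₀ r with hBd
  have hBo : IsOpen B := Metric.isOpen_ball
  have hB : MeasurableSet B := hBo.measurableSet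
  have : IsFiniteMeasure (volume.restrict B) := ⟨by simpa using measure_ball_lt_top⟩
  obtain ⟨C, hC, hinterp⟩ := exists_gagliardoPow_interpolate_le (n := n) hn hs1 hp
  -- A measurable representative, clamped and cut off so that bounds and support hold at every
  -- point, as mollification requires.
  set w' : 𝔼 → ℝ := (Metric.closedBall x₀ ρ₀).indicator
    (fun x => max 0 (min (hwm.mk w x) 1)) with hw'
  have hw'm : Measurable w' := by
    have := hwm.measurable_mk
    exact Measurable.indicator (by fun_prop) Metric.isClosed_closedBall.measurableSet
  have hw'I : ∀ x, w' x ∈ Icc (0 : ℝ) 1 := by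
    intro x
    by_cases hx : x ∈ Metric.closedBall x₀ ρ₀
    · rw [hw', indicator_of_mem hx]
      exact ⟨le_max_left _ _, max_le zero_le_one (min_le_right _ _)⟩
    · rw [hw', indicator_of_notMem hx]
      exact ⟨le_rfl, zero_le_one⟩
  have hw'0 : ∀ x ∉ Metric.closedBall x₀ ρ₀, w' x = 0 := fun x hx => indicator_of_notMem hx _
  have hww' : w =ᵐ[volume.restrict B] w' := by
    filter_upwards [hwm.ae_eq_mk] with x hx
    by_cases hxρ : x ∈ Metric.closedBall x₀ ρ₀
    · rw [hw', indicator_of_mem hxρ, ← hx, min_eq_left (hwI x).2, max_eq_right (hwI x).1]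
    · rw [hw0 x hxρ, hw'0 x hxρ]
  have hmain : ∀ ε : ℝ, 0 < ε → fracCap s p E B ≤ 2 ^ p * gagliardoPow s p B w +
      2 ^ (p - 1) * (ENNReal.ofReal ε + ENNReal.ofReal ε + ENNReal.ofReal ε) := by
    intro ε hε
    obtain ⟨G, hGo, hGB, hGε, hGc⟩ := hwq ε hε
    obtain ⟨g, ψ, hg, hψm, hψI, hψε, hlim, hψ1⟩ := exists_potential_of_fracCap_lt hp hGo hGB hGε
    obtain ⟨O, hO, hOe⟩ := continuousOn_iff'.1 hGc (Ioi (1 / 2)) isOpen_Ioi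
    set A := (O ∩ B) ∪ G with hA
    have hAo : IsOpen A := (hO.inter hBo).union hGo
    have hAB : A ⊆ B := union_subset inter_subset_right hGB
    have hEA : E ⊆ A := by
      intro x hx
      by_cases hxG : x ∈ G
      · exact Or.inr hxG
      · have hx1 : x ∈ w ⁻¹' Ioi (1 / 2) ∩ (B \ G) :=
          ⟨by rw [mem_preimage, hwE x hx, mem_Ioi]; norm_num, hE hx, hxG⟩
        rw [hOe] at hx1
        exact Or.inl ⟨hx1.1, hE hx⟩
    have hAw : ∀ x ∈ A, x ∉ G → 1 / 2 < w x := by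
      intro x hx hxG
      rcases hx with hx | hx
      · have hx1 : x ∈ O ∩ (B \ G) := ⟨hx.1, hx.2, hxG⟩
        rw [← hOe] at hx1
        exact hx1.1
      · exact absurd hx hxG
    refine iInf_le_of_le A (iInf_le_of_le hAo (iInf_le_of_le hEA (iInf_le_of_le hAB ?_)))
    refine iSup_le fun K => iSup_le fun hK => iSup_le fun hKA => ?_
    -- A compact set stays away from the sphere, which leaves an annulus in which to pass from `ψ`
    -- to a compactly supported `g k`.
    obtain ⟨ρ₁, hρ₁, hKρ⟩ := exists_lt_subset_ball hK.isClosed (hKA.trans hAB)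
    set ρ₂ := (ρ₁ + r) / 2 with hρ₂
    have h12 : ρ₁ < ρ₂ := by rw [hρ₂]; linarith
    have h2r : ρ₂ < r := by rw [hρ₂]; linarith
    set ζ := radialCutoff x₀ ρ₁ ρ₂ with hζ
    set L : ℝ := 1 / (ρ₂ - ρ₁) with hL
    have hL0 : 0 ≤ L := by rw [hL]; have := sub_pos.2 h12; positivity
    set c := C * ENNReal.ofReal L ^ p * ENNReal.ofReal r ^ (p - s * p) with hc
    have hct : c ≠ ⊤ := by
      refine ENNReal.mul_ne_top (ENNReal.mul_ne_top hC
        (ENNReal.rpow_ne_top_of_nonneg hp0.le ENNReal.ofReal_ne_top))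
        (ENNReal.rpow_ne_top_of_nonneg (by nlinarith) ENNReal.ofReal_ne_top)
    -- The gluing constant `c` depends on `K` but not on `k`, so dominated convergence makes the
    -- gluing cost at most `ε` for some `k`.
    have hsmall : Tendsto (fun k => c * ∫⁻ x in B, ‖ψ x - g k x‖ₑ ^ p) atTop (𝓝 (c * 0)) := by
      refine ENNReal.Tendsto.const_mul ?_ (Or.inr hct)
      have := tendsto_lintegral_of_dominated_convergence (μ := volume.restrict B)
        (F := fun k x => ‖ψ x - g k x‖ₑ ^ p) (f := fun _ => 0) (fun _ => 1)
        (fun k => by have := (hg k).1; fun_prop) (fun k => Eventually.of_forall fun x => ?_)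
        (by simpa using measure_ball_lt_top.ne) ?_
      · simpa using this
      · have h1 : ‖ψ x - g k x‖ ≤ 1 := by
          rw [Real.norm_eq_abs, abs_le]
          have h1 := hψI x
          have h2 := (hg k).2.1 x
          constructor <;> linarith [h1.1, h1.2, h2.1, h2.2]
        refine ENNReal.rpow_le_one ?_ hp0.le
        rw [← ofReal_norm]
        simpa using h1
      · filter_upwards [hlim] with x hx
        have h1 : Tendsto (fun k => ‖ψ x - g k x‖ₑ ^ p) atTop (𝓝 (‖ψ x - ψ x‖ₑ ^ p)) :=
          (ENNReal.continuous_rpow_const.tendsto _).comp ((continuous_enorm.tendsto _).comp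
            (tendsto_const_nhds.sub hx))
        simpa [hp0] using h1
    rw [mul_zero] at hsmall
    obtain ⟨k, hk⟩ := (hsmall.eventually (ge_mem_nhds (ENNReal.ofReal_pos.2 hε))).exists
    obtain ⟨hgm, hgI, ⟨ρ₃, hρ₃, hg0⟩, hgε⟩ := hg k
    -- Equal to `ψ` near `K`, hence at least one a.e. on `G` there, and equal to the compactly
    -- supported `g k` near the sphere.
    set h : 𝔼 → ℝ := fun x => (1 - ζ x) * g k x + ζ x * ψ x with hh
    have hζm : Measurable ζ := measurable_radialCutoff _ _ _
    have hhm : Measurable h := by fun_prop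
    have hζI := radialCutoff_mem_Icc x₀ ρ₁ ρ₂
    have hhI : ∀ x, h x ∈ Icc (0 : ℝ) 1 := by
      intro x
      have h1 := hψI x
      have h2 := hgI x
      have h3 : ζ x ∈ Icc (0 : ℝ) 1 := hζI x
      exact (convex_Icc (0 : ℝ) 1) h2 h1 (sub_nonneg.2 h3.2) h3.1 (by ring)
    have hhE : gagliardoPow s p B h ≤
        2 ^ (p - 1) * (ENNReal.ofReal ε + ENNReal.ofReal ε + ENNReal.ofReal ε) := by
      refine (hinterp x₀ r hr L ζ (g k) ψ hL0 hgm hψm hζI (abs_radialCutoff_sub_le h12)).trans ?_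
      gcongr
    set ρ := max ρ₀ (max ρ₂ ρ₃) with hρ
    have hρr : ρ < r := max_lt hρ₀ (max_lt h2r hρ₃)
    have hcap := compactCap_ball_le_gagliardoPow (s := s) (p := p) (x₀ := x₀) (M := 2)
      (Φ := fun x => max (2 * w' x) (h x)) hp hs0 hr hρr hK
      (hAo.inter Metric.isOpen_ball) (subset_inter hKA hKρ) (by fun_prop) ?_ ?_ ?_
    · refine hcap.trans ((gagliardoPow_max_le hp0.le hB (by fun_prop) hhm).trans ?_)
      rw [gagliardoPow_const_mul s hp0.le, gagliardoPow_congr_ae hww']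
      refine add_le_add (le_of_eq ?_) hhE
      rw [Real.enorm_of_nonneg zero_le_two, ENNReal.ofReal_ofNat]
    · intro x
      have h1 := hw'I x
      have h2 := hhI x
      rw [Real.norm_of_nonneg (le_max_of_le_right h2.1)]
      exact max_le (by linarith [h1.2]) (by linarith [h2.2])
    · intro x hx
      have h0 : x ∉ Metric.closedBall x₀ ρ₀ := fun h =>
        hx (Metric.closedBall_subset_closedBall (le_max_left _ _) h)
      have h2 : x ∉ Metric.closedBall x₀ ρ₂ := fun h =>
        hx (Metric.closedBall_subset_closedBall ((le_max_left _ _).trans (le_max_right _ _)) h)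
      have h3 : x ∉ Metric.closedBall x₀ ρ₃ := fun h =>
        hx (Metric.closedBall_subset_closedBall ((le_max_right _ _).trans (le_max_right _ _)) h)
      have e1 : ζ x = 0 := radialCutoff_eq_zero h12 h2
      simp [hh, hw'0 x h0, hg0 x h3, e1]
    · filter_upwards [(ae_restrict_iff' hB).1 hww', (ae_restrict_iff' hB).1 hψ1] with x h1 h2 hxU
      have hxB := hAB hxU.1
      by_cases hxG : x ∈ G
      · have e1 : ζ x = 1 := radialCutoff_eq_one h12 (Metric.ball_subset_closedBall hxU.2)
        refine le_max_of_le_right ?_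
        simp only [hh, e1, sub_self, zero_mul, zero_add, one_mul]
        exact h2 hxB hxG
      · refine le_max_of_le_left ?_
        have h3 := hAw x hxU.1 hxG
        rw [h1 hxB] at h3
        linarith
  have hlim : Tendsto (fun ε : ℝ => 2 ^ p * gagliardoPow s p B w +
      2 ^ (p - 1) * (ENNReal.ofReal ε + ENNReal.ofReal ε + ENNReal.ofReal ε)) (𝓝[>] 0)
      (𝓝 (2 ^ p * gagliardoPow s p B w)) := by
    have h0 : Tendsto (fun ε : ℝ => ENNReal.ofReal ε) (𝓝[>] 0) (𝓝 0) := by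
      simpa using (ENNReal.continuous_ofReal.tendsto 0).mono_left
        (nhdsWithin_le_nhds (s := Ioi (0 : ℝ)))
    have h1 := ENNReal.Tendsto.const_mul (a := 2 ^ (p - 1)) ((h0.add h0).add h0)
      (Or.inr (ENNReal.rpow_ne_top_of_nonneg (by linarith) (by simp)))
    simpa using h1.const_add (2 ^ p * gagliardoPow s p B w)
  exact ge_of_tendsto hlim (eventually_nhdsWithin_of_forall fun ε hε => hmain ε hε)

end Capacity

/-! ### The competitor built from `u`, and the conclusion -/

section Main
variable {n : ℕ}
local notation "𝔼" => EuclideanSpace ℝ (Fin n)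

theorem volume_ball_rpow {x₀ : 𝔼} {r : ℝ} (hn : 1 ≤ n) (hr : 0 < r) (a : ℝ) (ha : 0 ≤ a) :
    volume (Metric.ball x₀ r) ^ (a / n) =
      ENNReal.ofReal r ^ a * volume (Metric.ball (0 : 𝔼) 1) ^ (a / n) := by
  have hn0 : (0 : ℝ) < n := by exact_mod_cast hn
  rw [Measure.addHaar_ball_of_pos _ _ hr, finrank_euclideanSpace, Fintype.card_fin,
    ENNReal.mul_rpow_of_nonneg _ _ (by positivity), ENNReal.ofReal_pow hr.le,
    ← ENNReal.rpow_natCast, ← ENNReal.rpow_mul]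
  congr 2
  field_simp

/-- A nonnegative function is close in `L^p` to its normalized `L^{p^*}` norm. -/
theorem exists_lintegral_sub_average_le (hn : 1 ≤ n) {s p : ℝ} (hs0 : 0 < s) (hp : 1 ≤ p)
    (hpn : p < n / s) :
    ∃ C : ℝ≥0∞, C ≠ ⊤ ∧ ∀ (x₀ : 𝔼) (r : ℝ), 0 < r → ∀ f : 𝔼 → ℝ, Measurable f →
      (∀ x, 0 ≤ f x) → gagliardoPow s p (Metric.ball x₀ r) f ≠ ⊤ → ∀ a : ℝ≥0∞,
      a = ((volume (Metric.ball x₀ r))⁻¹ *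
        ∫⁻ x in Metric.ball x₀ r, ‖f x‖ₑ ^ fracSobolevExp n s p) ^ (1 / fracSobolevExp n s p) →
      a ≠ ⊤ ∧ ∫⁻ x in Metric.ball x₀ r, ‖f x - a.toReal‖ₑ ^ p ≤
        C * ENNReal.ofReal r ^ (s * p) * gagliardoPow s p (Metric.ball x₀ r) f := by
  obtain ⟨hθ0, hθ1, hpq, hθ⟩ := fracSobolevExp_spec hs0 hp hpn
  obtain ⟨C, hC, H⟩ := exists_lintegral_sub_rpow_le (n := n) hn hs0 hp hpn
  set q := fracSobolevExp n s p
  have hp0 : 0 < p := by linarith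
  have hq0 : 0 < q := by linarith
  have hq1 : 1 ≤ q := by linarith
  set V₁ := volume (Metric.ball (0 : 𝔼) 1) with hV₁
  have hV₁t : V₁ ≠ ⊤ := measure_ball_lt_top.ne
  refine ⟨2 ^ p * C ^ (p / q) * V₁ ^ (s * p / n), ?_, ?_⟩
  · refine ENNReal.mul_ne_top (ENNReal.mul_ne_top (ENNReal.rpow_ne_top_of_nonneg hp0.le (by simp))
      (ENNReal.rpow_ne_top_of_nonneg (by positivity) hC))
      (ENNReal.rpow_ne_top_of_nonneg hθ0.le hV₁t)
  intro x₀ r hr f hf hf0 hG a ha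
  set B := Metric.ball x₀ r with hB
  set μ := volume.restrict B with hμ
  set V := volume B with hV
  have hVt : V ≠ ⊤ := measure_ball_lt_top.ne
  have hV0 : V ≠ 0 := (Metric.measure_ball_pos volume _ hr).ne'
  have hμV : μ univ = V := by simp [hμ, hV]
  have hμ0 : μ ≠ 0 := by
    intro h; rw [h] at hμV; exact hV0 (by simpa using hμV.symm)
  have hconst : ∀ t : ℝ, 0 ≤ t → eLpNorm' (fun _ : 𝔼 => t) q μ =
      ENNReal.ofReal t * V ^ (1 / q) := by
    intro t ht
    rw [eLpNorm'_const t hq0, hμV, Real.enorm_of_nonneg ht]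
  have hVq0 : V ^ (1 / q) ≠ 0 := (ENNReal.rpow_pos (pos_iff_ne_zero.2 hV0) hVt).ne'
  have hVqt : V ^ (1 / q) ≠ ⊤ := ENNReal.rpow_ne_top_of_nonneg (by positivity) hVt
  have hfa : eLpNorm' f q μ = a * V ^ (1 / q) := by
    rw [eLpNorm'_eq_lintegral_enorm, ha, ← ENNReal.mul_rpow_of_nonneg _ _ (by positivity),
      mul_right_comm, ENNReal.inv_mul_cancel hV0 hVt, one_mul]
  obtain ⟨m₀, hm₀⟩ := H x₀ r f hf
  -- Since `f` is nonnegative, replacing the constant by its absolute value only brings it closer; a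
  -- nonnegative constant has `L^q` norm `m · V^(1/q)`, to be compared with that of `f`.
  set m := |m₀| with hm
  have hmS : ∫⁻ x in B, ‖f x - m‖ₑ ^ q ≤ C * gagliardoPow s p B f ^ (q / p) := by
    refine le_trans (lintegral_mono fun x => ENNReal.rpow_le_rpow ?_ hq0.le) hm₀
    refine enorm_le_iff_norm_le.2 ?_
    have := abs_abs_sub_abs_le (f x) m₀
    rwa [abs_of_nonneg (hf0 x)] at this
  set N := eLpNorm' (fun x => f x - m) q μ with hN
  have hNS : N ^ p ≤ C ^ (p / q) * gagliardoPow s p B f := by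
    rw [hN, eLpNorm'_eq_lintegral_enorm, ← ENNReal.rpow_mul]
    calc _ ≤ (C * gagliardoPow s p B f ^ (q / p)) ^ (1 / q * p) :=
          ENNReal.rpow_le_rpow hmS (by positivity)
      _ = _ := by
          rw [show 1 / q * p = p / q by ring, ENNReal.mul_rpow_of_nonneg _ _ (by positivity),
            ← ENNReal.rpow_mul, show q / p * (p / q) = 1 by field_simp, ENNReal.rpow_one]
  have hNt : N ≠ ⊤ := by
    intro h
    rw [h, ENNReal.top_rpow_of_pos hp0, top_le_iff] at hNS
    exact ENNReal.mul_ne_top (ENNReal.rpow_ne_top_of_nonneg (by positivity) hC) hG hNS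
  have hm0 : 0 ≤ m := abs_nonneg _
  have hfm : AEStronglyMeasurable f μ := hf.aestronglyMeasurable
  have hNm : AEStronglyMeasurable (fun x => f x - m) μ :=
    (hf.sub_const m).aestronglyMeasurable
  have htri1 : a * V ^ (1 / q) ≤ N + ENNReal.ofReal m * V ^ (1 / q) := by
    rw [← hfa, ← hconst m hm0]
    refine le_trans (le_of_eq ?_) (eLpNorm'_add_le hNm aestronglyMeasurable_const hq1)
    congr 1
    funext x
    simp
  have hat : a ≠ ⊤ := by
    intro h
    rw [h, ENNReal.top_mul hVq0, top_le_iff] at htri1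
    exact ENNReal.add_ne_top.2 ⟨hNt, ENNReal.mul_ne_top ENNReal.ofReal_ne_top hVqt⟩ htri1
  refine ⟨hat, ?_⟩
  have htri2 : ENNReal.ofReal m * V ^ (1 / q) ≤ N + a * V ^ (1 / q) := by
    rw [← hfa, ← hconst m hm0]
    have hneg : eLpNorm' (fun x => m - f x) q μ = N := by
      simp only [hN, eLpNorm'_eq_lintegral_enorm]
      congr 2
      funext x
      rw [← enorm_neg, neg_sub]
    rw [← hneg]
    refine le_trans (le_of_eq ?_) (eLpNorm'_add_le (f := fun x => m - f x)
      (hf.const_sub m).aestronglyMeasurable hfm hq1)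
    congr 1
    funext x
    simp
  set α := a.toReal with hα
  have hα0 : 0 ≤ α := ENNReal.toReal_nonneg
  have haα : a = ENNReal.ofReal α := (ENNReal.ofReal_toReal hat).symm
  -- The constant `α` has the same `L^q` norm as `f`, so by the reverse triangle inequality it is no
  -- farther from `m` than `f` is. Hence `α` can replace `m` at the cost of a factor two.
  have hdist : eLpNorm' (fun _ : 𝔼 => m - α) q μ ≤ N := by
    rw [eLpNorm'_const _ hq0, hμV]
    rcases le_total α m with h | h
    · rw [Real.enorm_of_nonneg (sub_nonneg.2 h), ENNReal.ofReal_sub _ hα0, ← haα,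
        ENNReal.sub_mul fun _ _ => hVqt]
      exact tsub_le_iff_right.2 htri2
    · rw [← enorm_neg, neg_sub, Real.enorm_of_nonneg (sub_nonneg.2 h), ENNReal.ofReal_sub _ hm0,
        ← haα, ENNReal.sub_mul fun _ _ => hVqt]
      exact tsub_le_iff_right.2 htri1
  have hfα : eLpNorm' (fun x => f x - α) q μ ≤ 2 * N := by
    rw [two_mul]
    refine le_trans ?_ (add_le_add le_rfl hdist)
    refine le_trans (le_of_eq ?_) (eLpNorm'_add_le hNm aestronglyMeasurable_const hq1)
    congr 1
    funext x
    simp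
  have hholder := eLpNorm'_le_eLpNorm'_mul_rpow_measure_univ (μ := μ) hp0 hpq
    (hf.sub_const α).aestronglyMeasurable
  rw [hμV] at hholder
  calc ∫⁻ x in B, ‖f x - α‖ₑ ^ p = eLpNorm' (fun x => f x - α) p μ ^ p := by
        rw [eLpNorm'_eq_lintegral_enorm, ← ENNReal.rpow_mul, one_div, inv_mul_cancel₀ hp0.ne',
          ENNReal.rpow_one]
    _ ≤ (2 * N * V ^ (1 / p - 1 / q)) ^ p := by
        refine ENNReal.rpow_le_rpow (hholder.trans ?_) hp0.le
        gcongr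
    _ = 2 ^ p * N ^ p * V ^ (s * p / n) := by
        rw [ENNReal.mul_rpow_of_nonneg _ _ hp0.le, ENNReal.mul_rpow_of_nonneg _ _ hp0.le,
          ← ENNReal.rpow_mul]
        congr 2
        rw [sub_mul, one_div, inv_mul_cancel₀ hp0.ne', one_div_mul_eq_div, ← hθ]
        ring
    _ ≤ 2 ^ p * (C ^ (p / q) * gagliardoPow s p B f) * V ^ (s * p / n) := by gcongr
    _ = _ := by
        rw [hV, hB, volume_ball_rpow hn hr (s * p) (by positivity)]
        ring

/-- The cut-off function `η · (1 - |u|/a)₊` is quasi continuous together with `u`, equals one on the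
set in question, and has energy of order `a^(-p)` times that of `u`. -/
theorem exists_fracCap_zeroSet_le (hn : 1 ≤ n) {s p lam : ℝ} (hs0 : 0 < s) (hs1 : s < 1)
    (hp : 1 ≤ p) (hpn : p < n / s) (hlam1 : lam < 1) :
    ∃ D : ℝ≥0∞, D ≠ ⊤ ∧ ∀ (x₀ : 𝔼) (r : ℝ), 0 < r → ∀ u : 𝔼 → ℝ,
      MemFracSobolev s p (Metric.ball x₀ r) u →
      IsFracQuasiContinuous s p (Metric.ball x₀ r) u → ∀ a : ℝ≥0∞,
      a = ((volume (Metric.ball x₀ r))⁻¹ *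
        ∫⁻ x in Metric.ball x₀ r, ‖u x‖ₑ ^ fracSobolevExp n s p) ^ (1 / fracSobolevExp n s p) →
      a ≠ 0 → a ≠ ⊤ ∧
      fracCap s p (zeroSetIn (Metric.ball x₀ r) u ∩ Metric.closedBall x₀ (lam * r))
        (Metric.ball x₀ r) ≤ D * (a ^ p)⁻¹ * gagliardoPow s p (Metric.ball x₀ r) u := by
  obtain ⟨C, hC, H⟩ := exists_lintegral_sub_average_le (n := n) hn hs0 hp hpn
  obtain ⟨C₁, hC₁, hinterp⟩ := exists_gagliardoPow_interpolate_le (n := n) hn hs1 hp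
  have hp0 : 0 < p := by linarith
  set l : ℝ := 2 / (1 - lam) with hl
  have hl0 : 0 < l := div_pos two_pos (sub_pos.2 hlam1)
  refine ⟨2 ^ p * 2 ^ (p - 1) * (1 + C₁ * ENNReal.ofReal l ^ p * C), ?_, ?_⟩
  · refine ENNReal.mul_ne_top (ENNReal.mul_ne_top (ENNReal.rpow_ne_top_of_nonneg hp0.le (by simp))
      (ENNReal.rpow_ne_top_of_nonneg (by linarith) (by simp))) (ENNReal.add_ne_top.2 ⟨by simp, ?_⟩)
    exact ENNReal.mul_ne_top (ENNReal.mul_ne_top hC₁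
      (ENNReal.rpow_ne_top_of_nonneg hp0.le ENNReal.ofReal_ne_top)) hC
  rintro x₀ r hr u ⟨huL, huG⟩ huq a ha ha0
  set B := Metric.ball x₀ r with hBd
  have hB : MeasurableSet B := Metric.isOpen_ball.measurableSet
  have hum : AEMeasurable u (volume.restrict B) := huL.1.aemeasurable
  set u' := hum.mk u with hu'
  have hu'm : Measurable u' := hum.measurable_mk
  have huu' : u =ᵐ[volume.restrict B] u' := hum.ae_eq_mk
  set f : 𝔼 → ℝ := fun x => |u' x| with hf
  have hfm : Measurable f := by fun_prop
  have hf0 : ∀ x, 0 ≤ f x := fun x => abs_nonneg _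
  have hfG : gagliardoPow s p B f ≤ gagliardoPow s p B u := by
    rw [gagliardoPow_congr_ae huu']
    exact gagliardoPow_mono hp0.le hB fun x _ y _ => abs_abs_sub_abs_le _ _
  have hfa : a = ((volume B)⁻¹ * ∫⁻ x in B, ‖f x‖ₑ ^ fracSobolevExp n s p) ^
      (1 / fracSobolevExp n s p) := by
    rw [ha]
    congr 2
    refine lintegral_congr_ae ?_
    filter_upwards [huu'] with x hx
    rw [hx, hf, Real.enorm_abs]
  obtain ⟨hat, hfα⟩ := H x₀ r hr f hfm hf0 (hfG.trans_lt huG).ne a hfa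
  refine ⟨hat, ?_⟩
  set α := a.toReal with hα
  have hα0 : 0 < α := ENNReal.toReal_pos ha0 hat
  have hαp : ‖α⁻¹‖ₑ ^ p = (a ^ p)⁻¹ := by
    rw [Real.enorm_of_nonneg (by positivity), ENNReal.ofReal_inv_of_pos hα0,
      ENNReal.ofReal_toReal hat, ENNReal.inv_rpow]
  -- Midway between `lam * r` and `r`, so the cutoff has Lipschitz constant `l / r`.
  set b : ℝ := (1 + lam) / 2 * r with hb
  have hab : lam * r < b := by rw [hb]; nlinarith
  have hbr : b < r := by rw [hb]; nlinarith
  set η := radialCutoff x₀ (lam * r) b with hη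
  have hηI := radialCutoff_mem_Icc x₀ (lam * r) b
  set w : 𝔼 → ℝ := fun x => η x * max (1 - α⁻¹ * |u x|) 0 with hw
  set h : 𝔼 → ℝ := fun x => max (1 - α⁻¹ * f x) 0 with hh
  have hhm : Measurable h := by fun_prop
  have hwh : w =ᵐ[volume.restrict B] fun x => (1 - η x) * (0 : ℝ) + η x * h x := by
    filter_upwards [huu'] with x hx
    simp only [hw, hh, hf, hx, mul_zero, zero_add]
  have hηm : Measurable η := measurable_radialCutoff _ _ _
  have hcap := fracCap_le_of_quasiContinuous hn hs0.le hs1 hp (x₀ := x₀) hr hbr (w := w)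
    (E := zeroSetIn B u ∩ Metric.closedBall x₀ (lam * r)) (fun x hx => hx.1.1) ?_ ?_ ?_ ?_ ?_
  rotate_left
  · exact ⟨_, by fun_prop, hwh⟩
  · intro x
    have h1 : η x ∈ Icc (0 : ℝ) 1 := hηI x
    have h2 : 0 ≤ max (1 - α⁻¹ * |u x|) 0 := le_max_right _ _
    have h3 : max (1 - α⁻¹ * |u x|) 0 ≤ 1 := by
      refine max_le ?_ zero_le_one
      have : 0 ≤ α⁻¹ * |u x| := by positivity
      linarith
    exact ⟨mul_nonneg h1.1 h2, mul_le_one₀ h1.2 h2 h3⟩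
  · intro x hx
    have e : η x = 0 := radialCutoff_eq_zero hab hx
    simp only [hw, e, zero_mul]
  · intro x hx
    have e : η x = 1 := radialCutoff_eq_one hab hx.2
    have e' : u x = 0 := hx.1.2
    simp [hw, e, e']
  · intro ε hε
    obtain ⟨G, hG1, hG2, hG3, hG4⟩ := huq ε hε
    refine ⟨G, hG1, hG2, hG3, ?_⟩
    have hηc : ContinuousOn η (B \ G) := (continuous_radialCutoff _ _ _).continuousOn
    exact hηc.mul ((continuousOn_const.sub (continuousOn_const.mul hG4.abs)).sup continuousOn_const)
  refine hcap.trans ?_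
  rw [gagliardoPow_congr_ae hwh]
  have hL0 : 0 ≤ 1 / (b - lam * r) := by have := sub_pos.2 hab; positivity
  have hLr : 1 / (b - lam * r) = l * r⁻¹ := by
    have h1 : b - lam * r = (1 - lam) / 2 * r := by rw [hb]; ring
    have h2 : 1 - lam ≠ 0 := (sub_pos.2 hlam1).ne'
    rw [h1, hl]
    field_simp
  have hi := hinterp x₀ r hr (1 / (b - lam * r)) η (fun _ => 0) h hL0 measurable_const hhm hηI
    (abs_radialCutoff_sub_le hab)
  have hzero : gagliardoPow s p B (fun _ : 𝔼 => (0 : ℝ)) = 0 := by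
    simp [gagliardoPow, hp0]
  have hhG : gagliardoPow s p B h ≤ (a ^ p)⁻¹ * gagliardoPow s p B u := by
    calc gagliardoPow s p B h ≤ gagliardoPow s p B (fun x => α⁻¹ * f x) := by
          refine gagliardoPow_mono hp0.le hB fun x _ y _ => ?_
          refine (abs_max_sub_max_le_max _ _ _ _).trans (le_of_eq ?_)
          rw [sub_self, abs_zero, max_eq_left (abs_nonneg _), sub_sub_sub_cancel_left,
            abs_sub_comm]
      _ = (a ^ p)⁻¹ * gagliardoPow s p B f := by rw [gagliardoPow_const_mul s hp0.le, hαp]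
      _ ≤ _ := by gcongr
  -- Truncating at level `α` gives `h ≤ α⁻¹ |f - α|`, so the zeroth-order term is controlled by the
  -- oscillation of `f` instead of its size.
  have hhI : ∫⁻ x in B, ‖h x - 0‖ₑ ^ p ≤
      (a ^ p)⁻¹ * (C * ENNReal.ofReal r ^ (s * p) * gagliardoPow s p B u) := by
    have hat' : (a ^ p)⁻¹ ≠ ⊤ := by
      rw [← hαp]; exact ENNReal.rpow_ne_top_of_nonneg hp0.le enorm_ne_top
    calc ∫⁻ x in B, ‖h x - 0‖ₑ ^ p ≤ ∫⁻ x in B, (a ^ p)⁻¹ * ‖f x - α‖ₑ ^ p := by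
          refine lintegral_mono fun x => ?_
          rw [← hαp, ← ENNReal.mul_rpow_of_nonneg _ _ hp0.le, ← enorm_mul]
          refine ENNReal.rpow_le_rpow (enorm_le_iff_norm_le.2 ?_) hp0.le
          rw [sub_zero, Real.norm_of_nonneg (le_max_right _ _), Real.norm_eq_abs]
          refine max_le ?_ (abs_nonneg _)
          have e : 1 - α⁻¹ * f x = -(α⁻¹ * (f x - α)) := by field_simp; ring
          rw [e]
          exact neg_le_abs _
      _ = (a ^ p)⁻¹ * ∫⁻ x in B, ‖f x - α‖ₑ ^ p := lintegral_const_mul' _ _ hat'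
      _ ≤ _ := by
          gcongr
          exact hfα.trans (by gcongr)
  have hr0 : ENNReal.ofReal r ≠ 0 := by simpa using hr
  -- The powers `r^(-p)`, `r^(p-sp)` and `r^(sp)` cancel, which makes the constant independent of
  -- the radius.
  have hscale : ENNReal.ofReal (1 / (b - lam * r)) ^ p * ENNReal.ofReal r ^ (p - s * p) *
      ENNReal.ofReal r ^ (s * p) = ENNReal.ofReal l ^ p := by
    rw [mul_assoc, ← ENNReal.rpow_add _ _ hr0 ENNReal.ofReal_ne_top, sub_add_cancel,
      ← ENNReal.mul_rpow_of_nonneg _ _ hp0.le, ← ENNReal.ofReal_mul hL0, hLr, mul_assoc,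
      inv_mul_cancel₀ hr.ne', mul_one]
  calc _ ≤ 2 ^ p * (2 ^ (p - 1) * (0 + (a ^ p)⁻¹ * gagliardoPow s p B u +
        C₁ * ENNReal.ofReal (1 / (b - lam * r)) ^ p * ENNReal.ofReal r ^ (p - s * p) *
          ((a ^ p)⁻¹ * (C * ENNReal.ofReal r ^ (s * p) * gagliardoPow s p B u)))) := by
        refine mul_le_mul_right (hi.trans ?_) _
        rw [hzero]
        gcongr
    _ = 2 ^ p * 2 ^ (p - 1) * (1 + C₁ * (ENNReal.ofReal (1 / (b - lam * r)) ^ p *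
          ENNReal.ofReal r ^ (p - s * p) * ENNReal.ofReal r ^ (s * p)) * C) * (a ^ p)⁻¹ *
            gagliardoPow s p B u := by ring
    _ = _ := by rw [hscale]

end Main

theorem theorem1p1 (n : ℕ) (hn : 2 ≤ n) (s p lam : ℝ) (hs0 : 0 < s) (hs1 : s < 1)
    (hp1 : 1 ≤ p) (hpn : p < n / s) (hlam0 : 0 < lam) (hlam1 : lam < 1) :
    ∃ C : ℝ, 0 < C ∧
      ∀ (x₀ : EuclideanSpace ℝ (Fin n)) (r : ℝ), 0 < r →
      ∀ u : EuclideanSpace ℝ (Fin n) → ℝ,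
        MemFracSobolev s p (Metric.ball x₀ r) u →
        IsFracQuasiContinuous s p (Metric.ball x₀ r) u →
        0 < fracCap s p (zeroSetIn (Metric.ball x₀ r) u ∩ Metric.closedBall x₀ (lam * r))
              (Metric.ball x₀ r) →
        ((volume (Metric.ball x₀ r))⁻¹ *
            ∫⁻ x in Metric.ball x₀ r, ‖u x‖ₑ ^ fracSobolevExp n s p) ^ (1 / fracSobolevExp n s p) ≤
          ENNReal.ofReal C *
            ((fracCap s p (zeroSetIn (Metric.ball x₀ r) u ∩ Metric.closedBall x₀ (lam * r))
                (Metric.ball x₀ r))⁻¹ *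
              gagliardoPow s p (Metric.ball x₀ r) u) ^ (1 / p) := by
  obtain ⟨D, hD, H⟩ := exists_fracCap_zeroSet_le (n := n) (by omega) hs0 hs1 hp1 hpn hlam1
  have hp0 : 0 < p := by linarith
  have hDp : D ^ (1 / p) ≠ ⊤ := ENNReal.rpow_ne_top_of_nonneg (by positivity) hD
  -- The added one only secures positivity.
  refine ⟨(D ^ (1 / p)).toReal + 1, by positivity, ?_⟩
  intro x₀ r hr u hu huq hcap
  set cap := fracCap s p (zeroSetIn (Metric.ball x₀ r) u ∩ Metric.closedBall x₀ (lam * r))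
    (Metric.ball x₀ r)
  set G := gagliardoPow s p (Metric.ball x₀ r) u with hG
  set a := ((volume (Metric.ball x₀ r))⁻¹ *
    ∫⁻ x in Metric.ball x₀ r, ‖u x‖ₑ ^ fracSobolevExp n s p) ^ (1 / fracSobolevExp n s p) with ha
  rcases eq_or_ne a 0 with ha0 | ha0
  · rw [ha0]; exact bot_le
  obtain ⟨hat, hle⟩ := H x₀ r hr u hu huq a ha ha0
  have hap0 : a ^ p ≠ 0 := (ENNReal.rpow_pos (pos_iff_ne_zero.2 ha0) hat).ne'
  have hapt : a ^ p ≠ ⊤ := ENNReal.rpow_ne_top_of_nonneg hp0.le hat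
  -- Finiteness of the capacity comes from the estimate itself, and is needed to cancel it in
  -- `ℝ≥0∞`.
  have hcapt : cap ≠ ⊤ := ne_top_of_le_ne_top (ENNReal.mul_ne_top
    (ENNReal.mul_ne_top hD (ENNReal.inv_ne_top.2 hap0)) hu.2.ne) hle
  have hkey : a ^ p ≤ D * (cap⁻¹ * G) := by
    calc a ^ p = cap⁻¹ * (cap * a ^ p) := by
          rw [← mul_assoc, ENNReal.inv_mul_cancel hcap.ne' hcapt, one_mul]
      _ ≤ cap⁻¹ * (D * (a ^ p)⁻¹ * G * a ^ p) := by gcongr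
      _ = D * (cap⁻¹ * G) * ((a ^ p)⁻¹ * a ^ p) := by ring
      _ = D * (cap⁻¹ * G) := by rw [ENNReal.inv_mul_cancel hap0 hapt, mul_one]
  calc a = (a ^ p) ^ (1 / p) := by
        rw [← ENNReal.rpow_mul, mul_one_div_cancel hp0.ne', ENNReal.rpow_one]
    _ ≤ (D * (cap⁻¹ * G)) ^ (1 / p) := ENNReal.rpow_le_rpow hkey (by positivity)
    _ = D ^ (1 / p) * (cap⁻¹ * G) ^ (1 / p) := ENNReal.mul_rpow_of_nonneg _ _ (by positivity)
    _ ≤ _ := by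
        gcongr
        rw [ENNReal.ofReal_add ENNReal.toReal_nonneg zero_le_one, ENNReal.ofReal_toReal hDp]
        exact le_self_add
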